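/- Let $\mathbb{H}$ be the quaternions, $\mathbb{B}=\{q\in\mathbb{H}:|q|<1\}$, $I_{1,1}=\mathrm{diag}(1,-1)$, and let $$\mathrm{Sp}(1,1)=\{A\in M_2(\mathbb{H}) : A^*I_{1,1}A=I_{1,1}\},\qquad \mathrm{Sp}(1)I_2=\{uI_2 : u\in\mathbb{H},\ |u|=1\}.$$ For functions $f(q)=\sum_{n\ge0}q^na_n$ and $g(q)=\sum_{n\ge0}q^nb_n$ given by convergent power series on $\mathbb{B}$ put $(f*g)(q)=\sum_{n\ge0}q^n\sum_{k=0}^n a_kb_{n-k}$, $f^c(q)=\sum_{n\ge0}q^n\overline{a_n}$, $f^s=f*f^c$, and $f^{-*}=(f^s)^{-1}f^c$ (pointwise, where $f^s\neq0$). For $A=\begin{pmatrix}a&c\\ b&d\end{pmatrix}\in\mathrm{Sp}(1,1)$ the regular Möbius transformation associated to $A$ is the map $$\mathcal{F}_A:\mathbb{B}\to\mathbb{B},\qquad \mathcal{F}_A=l_{(c,d)}^{-*}*l_{(a,b)},\qquad\text{where } l_{(a,b)}(q)=qa+b,$$ and $\mathcal{M}(\mathbb{B})=\{\mathcal{F}_A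 : A\in\mathrm{Sp}(1,1)\}$. By a manifold structure on a set we mean a Hausdorff second countable topology with a maximal smooth atlas of charts in $\mathbb{R}^n$ for some $n$. **Theorem.** The map $$\psi:\mathrm{Sp}(1,1)/\mathrm{Sp}(1)I_2\to\mathcal{M}(\mathbb{B}),\qquad A\,\mathrm{Sp}(1)I_2\mapsto\mathcal{F}_{A^{-1}},$$ on the set of left cosets, is a well-defined bijection. Furthermore, $\mathrm{Sp}(1,1)$ has a unique manifold structure as an embedded submanifold of $M_2(\mathbb{H})\cong\mathbb{R}^{16}$, and $\mathrm{Sp}(1,1)/\mathrm{Sp}(1)I_2$ has a unique manifold structure for which the quotient map from $\mathrm{Sp}(1,1)$ is a submersion (a surjective smooth map whose differential at every point is surjective). With respect to it, $\mathcal{M}(\mathbb{B})$ has a unique manifold structure for which $\psi$ is a diffeomorphism, and for this structure $\mathcal{M}(\mathbb{B})$ has dimension $7$. -/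

import Mathlib

open scoped Quaternion Manifold ContDiff Matrix

noncomputable section

/-! ### Smooth manifold structures on a set -/

/-- A smooth manifold structure (without boundary, of some dimension `dim`) on a set `X`:
a Hausdorff second countable topology together with a maximal smooth atlas of charts
with values in `ℝ ^ dim`. -/
structure SmoothStructure (X : Type*) where
  /-- the dimension of the manifold -/
  dim : ℕ
  [top : TopologicalSpace X]
  t2 : T2Space X
  secondCountable : SecondCountableTopology X
  /-- the set of all smooth charts -/
  atlas : Set (OpenPartialHomeomorph X (EuclideanSpace ℝ (Fin dim)))
  cover : ∀ x : X, ∃ e ∈ atlas, x ∈ e.source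
  compatible : ∀ e ∈ atlas, ∀ e' ∈ atlas,
    e.symm ≫ₕ e' ∈ contDiffGroupoid ∞ 𝓘(ℝ, EuclideanSpace ℝ (Fin dim))
  maximal : ∀ e : OpenPartialHomeomorph X (EuclideanSpace ℝ (Fin dim)),
    (∀ e' ∈ atlas, e.symm ≫ₕ e' ∈ contDiffGroupoid ∞ 𝓘(ℝ, EuclideanSpace ℝ (Fin dim)) ∧
      e'.symm ≫ₕ e ∈ contDiffGroupoid ∞ 𝓘(ℝ, EuclideanSpace ℝ (Fin dim))) → e ∈ atlas

namespace SmoothStructure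

variable {X Y : Type*}

/-- The model space of a smooth structure. -/
abbrev Model (S : SmoothStructure X) : Type := EuclideanSpace ℝ (Fin S.dim)

/-- The underlying Mathlib charted space. -/
@[reducible] def chartedSpace (S : SmoothStructure X) :
    @ChartedSpace S.Model _ X S.top :=
  letI := S.top
  { atlas := S.atlas
    chartAt := fun x => (S.cover x).choose
    mem_chart_source := fun x => (S.cover x).choose_spec.2
    chart_mem_atlas := fun x => (S.cover x).choose_spec.1 }

theorem isManifold (S : SmoothStructure X) :
    letI := S.top
    letI := S.chartedSpace
    IsManifold 𝓘(ℝ, S.Model) ∞ X := by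
  let _ := S.top
  let _ := S.chartedSpace
  have : HasGroupoid X (contDiffGroupoid ∞ 𝓘(ℝ, S.Model)) :=
    ⟨fun {e e'} he he' => S.compatible e he e' he'⟩
  exact IsManifold.mk' _ _ _

/-- `f` is a diffeomorphism from `X` with the structure `S` onto `Y` with the structure `T`. -/
def IsDiffeomorphism (S : SmoothStructure X) (T : SmoothStructure Y) (f : X → Y) : Prop :=
  letI := S.top
  letI := S.chartedSpace
  letI := T.top
  letI := T.chartedSpace
  ∃ Φ : Diffeomorph 𝓘(ℝ, S.Model) 𝓘(ℝ, T.Model) X Y ∞, ∀ x, Φ x = f x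

/-- `f` is a submersion: a surjective smooth map whose differential at every point is
surjective. -/
def IsSurjectiveSubmersion (S : SmoothStructure X) (T : SmoothStructure Y) (f : X → Y) : Prop :=
  letI := S.top
  letI := S.chartedSpace
  letI := T.top
  letI := T.chartedSpace
  Function.Surjective f ∧ ContMDiff 𝓘(ℝ, S.Model) 𝓘(ℝ, T.Model) ∞ f ∧
    ∀ x, Function.Surjective (mfderiv 𝓘(ℝ, S.Model) 𝓘(ℝ, T.Model) f x)

/-- `f` is a smooth embedding into the vector space `V`: a smooth map that is a homeomorphism
onto its image and whose differential at every point is injective. -/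
def IsEmbeddingInto {V : Type*} [NormedAddCommGroup V] [NormedSpace ℝ V]
    (S : SmoothStructure X) (f : X → V) : Prop :=
  letI := S.top
  letI := S.chartedSpace
  Topology.IsEmbedding f ∧ ContMDiff 𝓘(ℝ, S.Model) 𝓘(ℝ, V) ∞ f ∧
    ∀ x, Function.Injective (mfderiv 𝓘(ℝ, S.Model) 𝓘(ℝ, V) f x)

end SmoothStructure

/-! ### The groups `Sp(1,1)` and `Sp(1) I₂` -/

/-- The matrix `I_{1,1} = diag(1, -1)`. -/
def I11 : Matrix (Fin 2) (Fin 2) ℍ[ℝ] := !![1, 0; 0, -1]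

theorem I11_mul_I11 : I11 * I11 = 1 := by
  ext i j : 1
  fin_cases i <;> fin_cases j <;> simp [I11, Matrix.mul_apply]

theorem I11_conjTranspose : I11ᴴ = I11 := by
  ext i j : 1
  fin_cases i <;> fin_cases j <;> simp [I11]

/-- `Sp(1,1)`, the quaternionic `2 × 2` matrices with `A* I_{1,1} A = I_{1,1}`. -/
def Sp11 : Submonoid (Matrix (Fin 2) (Fin 2) ℍ[ℝ]) where
  carrier := {A | Aᴴ * I11 * A = I11}
  one_mem' := by simp
  mul_mem' := by
    intro A B hA hB
    simp only [Set.mem_ofPred_eq] at *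
    rw [Matrix.conjTranspose_mul]
    calc Bᴴ * Aᴴ * I11 * (A * B) = Bᴴ * (Aᴴ * I11 * A) * B := by simp only [mul_assoc]
      _ = I11 := by rw [hA, hB]

theorem mem_Sp11 {A : Matrix (Fin 2) (Fin 2) ℍ[ℝ]} : A ∈ Sp11 ↔ Aᴴ * I11 * A = I11 := Iff.rfl

theorem Sp11.inv_mul_aux {A : Matrix (Fin 2) (Fin 2) ℍ[ℝ]} (hA : A ∈ Sp11) :
    I11 * Aᴴ * I11 * A = 1 := by
  rw [mul_assoc, mul_assoc, ← mul_assoc Aᴴ, mem_Sp11.1 hA, I11_mul_I11]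

theorem Sp11.inv_mem {A : Matrix (Fin 2) (Fin 2) ℍ[ℝ]} (hA : A ∈ Sp11) :
    I11 * Aᴴ * I11 ∈ Sp11 := by
  have h : A * (I11 * Aᴴ * I11) = 1 := mul_eq_one_symm (Sp11.inv_mul_aux hA)
  have h2 : A * I11 * Aᴴ = I11 := by
    calc A * I11 * Aᴴ = A * (I11 * Aᴴ * I11) * I11 := by
          simp only [mul_assoc, I11_mul_I11, mul_one]
      _ = I11 := by rw [h, one_mul]
  rw [mem_Sp11]
  simp only [Matrix.conjTranspose_mul, Matrix.conjTranspose_conjTranspose, I11_conjTranspose]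
  calc I11 * (A * I11) * I11 * (I11 * Aᴴ * I11)
      = I11 * (A * I11 * (I11 * I11) * Aᴴ) * I11 := by simp only [mul_assoc]
    _ = I11 := by rw [I11_mul_I11, mul_one, h2, I11_mul_I11, one_mul]

/-- `Sp(1,1)` is a group under matrix multiplication, with `A⁻¹ = I_{1,1} A* I_{1,1}`. -/
instance : Group Sp11 :=
  { (inferInstance : Monoid Sp11) with
    inv := fun A => ⟨I11 * A.1ᴴ * I11, Sp11.inv_mem A.2⟩
    inv_mul_cancel := fun A => Subtype.ext (Sp11.inv_mul_aux A.2) }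

/-- The subgroup `Sp(1) I₂` of `Sp(1,1)`, consisting of the matrices `u I₂` with `|u| = 1`. -/
def Sp1I2 : Subgroup Sp11 where
  carrier := {A | ∃ u : ℍ[ℝ], ‖u‖ = 1 ∧ A.1 = Matrix.diagonal (fun _ => u)}
  one_mem' := ⟨1, by simp, by simp⟩
  mul_mem' := by
    rintro A B ⟨u, hu, hA⟩ ⟨v, hv, hB⟩
    exact ⟨u * v, by simp [hu, hv], by simp [hA, hB]⟩
  inv_mem' := by
    rintro A ⟨u, hu, hA⟩
    refine ⟨star u, by simpa using hu, ?_⟩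
    change I11 * A.1ᴴ * I11 = _
    rw [hA, Matrix.diagonal_conjTranspose]
    ext i j : 1
    fin_cases i <;> fin_cases j <;> simp [I11, Matrix.mul_apply, Matrix.vecMul_diagonal]

/-- The inclusion of `Sp(1,1)` into the real vector space `M₂(ℍ)`, normed as a space of
functions of the two indices. -/
def Sp11.incl (A : Sp11) : Fin 2 → Fin 2 → ℍ[ℝ] := fun i j => A.1 i j

/-! ### Power series of a quaternionic variable and the `*`-product -/

/-- The unit ball of the quaternions. -/
abbrev QBall : Set ℍ[ℝ] := Metric.ball (0 : ℍ[ℝ]) 1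

/-- `f(q) = ∑ qⁿ aₙ` on the unit ball. -/
def HasRegularExpansion (f : QBall → ℍ[ℝ]) (a : ℕ → ℍ[ℝ]) : Prop :=
  ∀ q : QBall, HasSum (fun n => (q : ℍ[ℝ]) ^ n * a n) (f q)

/-- The coefficients of a power series expansion are determined by the function. -/
theorem HasRegularExpansion.unique {f : QBall → ℍ[ℝ]} {a b : ℕ → ℍ[ℝ]}
    (ha : HasRegularExpansion f a) (hb : HasRegularExpansion f b) : a = b := by
  classical
  let g : ℝ → ℍ[ℝ] := fun t => if h : (t : ℍ[ℝ]) ∈ QBall then f ⟨t, h⟩ else 0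
  have key : ∀ c : ℕ → ℍ[ℝ], HasRegularExpansion f c →
      HasFPowerSeriesAt g
        (fun n => ContinuousMultilinearMap.mkPiRing ℝ (Fin n) (c n) :
          FormalMultilinearSeries ℝ ℝ ℍ[ℝ]) 0 := by
    intro c hc
    refine hasFPowerSeriesAt_iff.2 ?_
    filter_upwards [Metric.ball_mem_nhds (0 : ℝ) one_pos] with t ht
    have ht' : (t : ℍ[ℝ]) ∈ QBall := by
      rw [mem_ball_zero_iff] at ht ⊢
      rwa [Quaternion.norm_coe]
    have hg : g (0 + t) = f ⟨t, ht'⟩ := by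
      simp only [zero_add, g]
      rw [dif_pos ht']
    rw [hg]
    have hterm : ∀ n : ℕ, t ^ n • FormalMultilinearSeries.coeff
        (fun n => ContinuousMultilinearMap.mkPiRing ℝ (Fin n) (c n) :
          FormalMultilinearSeries ℝ ℝ ℍ[ℝ]) n = (t : ℍ[ℝ]) ^ n * c n := by
      intro n
      rw [← Quaternion.coe_pow, Quaternion.coe_mul_eq_smul]
      congr 1
      refine (ContinuousMultilinearMap.mkPiRing_apply (c n) (1 : Fin n → ℝ)).trans ?_
      simp
    simp only [hterm]
    exact hc ⟨t, ht'⟩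
  have h := (key a ha).eq_formalMultilinearSeries (key b hb)
  funext n
  exact (ContinuousMultilinearMap.mkPiRing_eq_iff).1 (congrFun h n)

open Classical in
/-- The coefficients of the power series expansion of `f` on the unit ball (zero if `f` has no
such expansion, that is, if `f` is not slice regular). -/
def regularCoeff (f : QBall → ℍ[ℝ]) : ℕ → ℍ[ℝ] :=
  if h : ∃ a, HasRegularExpansion f a then h.choose else 0

theorem HasRegularExpansion.regularCoeff_eq {f : QBall → ℍ[ℝ]} {a : ℕ → ℍ[ℝ]}
    (ha : HasRegularExpansion f a) : regularCoeff f = a := by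
  have h : ∃ a, HasRegularExpansion f a := ⟨a, ha⟩
  rw [regularCoeff, dif_pos h]
  exact h.choose_spec.unique ha

/-- The function `q ↦ ∑ qⁿ aₙ` on the unit ball. -/
def regularSeries (a : ℕ → ℍ[ℝ]) : QBall → ℍ[ℝ] := fun q => ∑' n, (q : ℍ[ℝ]) ^ n * a n

/-- The regular product `f * g`, with coefficients `cₙ = ∑_{k ≤ n} aₖ bₙ₋ₖ`. -/
def starProd (f g : QBall → ℍ[ℝ]) : QBall → ℍ[ℝ] :=
  regularSeries fun n => ∑ k ∈ Finset.range (n + 1), regularCoeff f k * regularCoeff g (n - k)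

/-- The regular conjugate `f^c`. -/
def regularConj (f : QBall → ℍ[ℝ]) : QBall → ℍ[ℝ] :=
  regularSeries fun n => star (regularCoeff f n)

/-- The symmetrization `f^s = f * f^c`. -/
def symmetrization (f : QBall → ℍ[ℝ]) : QBall → ℍ[ℝ] := starProd f (regularConj f)

/-- The regular reciprocal `f^{-*} = (1 / f^s) f^c`, meaningful where `f^s` does not vanish. -/
def regularReciprocal (f : QBall → ℍ[ℝ]) : QBall → ℍ[ℝ] :=
  fun q => (symmetrization f q)⁻¹ * regularConj f q

/-- The function `l_{(a,b)}(q) = q a + b`. -/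
def linearFun (a b : ℍ[ℝ]) : QBall → ℍ[ℝ] := fun q => (q : ℍ[ℝ]) * a + b

/-- The regular Möbius transformation `𝓕_A = l_{(c,d)}^{-*} * l_{(a,b)}` for the matrix `A` with
rows `(a, c)` and `(b, d)`, as a map from the ball into the quaternions. -/
def regularMobius (A : Sp11) : QBall → ℍ[ℝ] :=
  starProd (regularReciprocal (linearFun (A.1 0 1) (A.1 1 1))) (linearFun (A.1 0 0) (A.1 1 0))

/-- The set `𝓜(𝔹)` of the maps `𝓕_A : 𝔹 → 𝔹` with `A` in `Sp(1,1)`. -/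
def RegularMobiusMaps : Set (QBall → QBall) :=
  {F | ∃ A : Sp11, ∀ q : QBall, (F q : ℍ[ℝ]) = regularMobius A q}

/-! ### The manifold structures of `Sp(1,1)` and of its quotient -/

/-- `G` makes `Sp(1,1)` an embedded submanifold of `M₂(ℍ)`. -/
def IsSubmanifoldStructure (G : SmoothStructure Sp11) : Prop :=
  G.IsEmbeddingInto Sp11.incl

/-- `Q` makes the projection of `Sp(1,1)`, with the structure `G`, onto the set of left cosets
of `Sp(1) I₂` a submersion. -/
def IsQuotientStructure (G : SmoothStructure Sp11) (Q : SmoothStructure (Sp11 ⧸ Sp1I2)) : Prop :=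
  G.IsSurjectiveSubmersion Q (fun A : Sp11 => (A : Sp11 ⧸ Sp1I2))

end

/-! The algebraic half rests on Taylor coefficients. For `A` with rows `(a, c)` and `(b, d)`, left
multiplication by a unit quaternion `u` does not change `𝓕_A`: the coefficients of `l_{(c,d)}^{-*}`
acquire `u⁻¹` on the right, which cancels the `u` in `ua` and `ub`. Conversely, the coefficients of
orders 0, 1, 2 recover `d⁻¹b`, `d⁻¹c` and `d⁻¹a`, and the relation `|d|² = 1 + |c|²` then fixes
`|d|`, so only a left unit factor is lost. Hence the fibres of `A ↦ 𝓕_A` are the right cosets of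
`Sp(1)I₂` (`regularMobius_eq_iff`), and inverting `A` turns them into left cosets. The ball is
preserved because `𝓕_A(q) = (d + pc)⁻¹(b + pa)` for a conjugate `p` of `q`, with `|d + pc|² - |b +
pa|² = 1 - |p|²` (`norm_regularMobius_lt_one`).

The geometric half uses global coordinates. With `ρ = √(1 + |v|²)`, the elements of `Sp(1,1)` are
exactly the matrices with rows `(ρs, v̄t)` and `(vs, ρt)`, where `v ∈ ℍ` and `s, t ∈ S³`
(`Sp11.coords`). The coordinates extend to a smooth map on all of `M₂(ℍ)`, so the inclusion is an
embedding. Right multiplication by `u` sends `(v, s, t)` to `(v, su, tu)`, so `(v, ts⁻¹)` identifies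
the quotient with `ℍ × S³`, of dimension `4 + 3 = 7`.

Uniqueness is formal: embeddings, surjective submersions and diffeomorphisms each make the identity
smooth in both directions between two candidate structures, and maximal atlases then agree
(`eq_of_smoothMap_id`). -/

open Set Filter Topology

/-! ### Local inverses, immersions and submersions -/

section LocalInverse

variable {E E' V : Type*} [NormedAddCommGroup E] [NormedSpace ℝ E]
  [NormedAddCommGroup E'] [NormedSpace ℝ E'] [NormedAddCommGroup V] [NormedSpace ℝ V]
  {M : Type*} [TopologicalSpace M] [ChartedSpace E M] [IsManifold 𝓘(ℝ, E) ∞ M]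
  {N : Type*} [TopologicalSpace N] [ChartedSpace E' N]

/-- The inverse function theorem on manifolds. -/
theorem ContMDiffAt.exists_local_inverse [FiniteDimensional ℝ E] {f : M → N} {x : M}
    (hf : ContMDiffAt 𝓘(ℝ, E) 𝓘(ℝ, E') ∞ f x)
    {D : E →L[ℝ] E'} (hD : HasMFDerivAt 𝓘(ℝ, E) 𝓘(ℝ, E') f x D) (hb : Function.Bijective D) :
    ∃ g : N → M, ContMDiffAt 𝓘(ℝ, E') 𝓘(ℝ, E) ∞ g (f x) ∧ g (f x) = x ∧
      (∀ᶠ y in 𝓝 x, g (f y) = y) ∧ ∀ᶠ z in 𝓝 (f x), f (g z) = z := by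
  let c := extChartAt 𝓘(ℝ, E) x
  let c' := extChartAt 𝓘(ℝ, E') (f x)
  let F : E → E' := writtenInExtChartAt 𝓘(ℝ, E) 𝓘(ℝ, E') x f
  have hF : ContDiffAt ℝ ∞ F (c x) := by
    have := (contMDiffAt_iff.1 hf).2
    rwa [modelWithCornersSelf_coe, Set.range_id, contDiffWithinAt_univ] at this
  have hd : HasFDerivAt F D (c x) := by
    have h := hD.2
    rw [modelWithCornersSelf_coe, Set.range_id] at h
    exact hasFDerivWithinAt_univ.1 h
  let A : E ≃L[ℝ] E' := (LinearEquiv.ofBijective (D : E →ₗ[ℝ] E') hb).toContinuousLinearEquiv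
  have hA : HasFDerivAt F (A : E →L[ℝ] E') (c x) := by
    have : (A : E →L[ℝ] E') = D := by ext v; rfl
    rwa [this]
  let φ := hF.toOpenPartialHomeomorph F hA (by simp)
  have hφx : c x ∈ φ.source := hF.mem_toOpenPartialHomeomorph_source hA (by simp)
  have hφ : ∀ v, φ v = F v := fun v => rfl
  have hFx : F (c x) = c' (f x) := by
    simp only [F, c, c', writtenInExtChartAt, Function.comp]
    rw [extChartAt_to_inv]
  have hsymm : φ.symm (c' (f x)) = c x := by
    rw [← hFx, ← hφ, φ.left_inv hφx]
  have hts : c' (f x) ∈ φ.target := by rw [← hFx]; exact φ.map_source hφx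
  have hcs : ContDiffAt ℝ ∞ φ.symm (c' (f x)) :=
    φ.contDiffAt_symm hts (f₀' := A) (by rw [hsymm]; exact hA) (by rw [hsymm]; exact hF)
  let g : N → M := fun z => c.symm (φ.symm (c' z))
  have hgx : g (f x) = x := by
    simp only [g, hsymm]; exact extChartAt_to_inv x
  have hg : ContMDiffAt 𝓘(ℝ, E') 𝓘(ℝ, E) ∞ g (f x) := by
    have h1 : ContMDiffAt 𝓘(ℝ, E') 𝓘(ℝ, E') ∞ c' (f x) := contMDiffAt_extChartAt
    have h2 : ContMDiffAt 𝓘(ℝ, E') 𝓘(ℝ, E) ∞ φ.symm (c' (f x)) := hcs.contMDiffAt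
    have h3 : ContMDiffAt 𝓘(ℝ, E) 𝓘(ℝ, E) ∞ c.symm (φ.symm (c' (f x))) := by
      rw [hsymm]
      exact (contMDiffOn_extChartAt_symm x).contMDiffAt (extChartAt_target_mem_nhds x)
    exact h3.comp (f x) (h2.comp (f x) h1)
  have hfx : ∀ᶠ y in 𝓝 x, f y ∈ c'.source :=
    hf.continuousAt.preimage_mem_nhds (extChartAt_source_mem_nhds (f x))
  refine ⟨g, hg, hgx, ?_, ?_⟩
  · have h1 : ∀ᶠ y in 𝓝 x, y ∈ c.source := extChartAt_source_mem_nhds x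
    have h2 : ∀ᶠ y in 𝓝 x, c y ∈ φ.source :=
      (continuousAt_extChartAt x).preimage_mem_nhds (φ.open_source.mem_nhds hφx)
    filter_upwards [h1, h2] with y hy hy2
    have : c' (f y) = φ (c y) := by
      simp only [hφ, F, writtenInExtChartAt, Function.comp, c', c]
      rw [PartialEquiv.left_inv _ hy]
    simp only [g, this, φ.left_inv hy2, c.left_inv hy]
  · have h1 : ∀ᶠ z in 𝓝 (f x), z ∈ c'.source := extChartAt_source_mem_nhds (f x)
    have h2 : ∀ᶠ z in 𝓝 (f x), c' z ∈ φ.target :=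
      (continuousAt_extChartAt (f x)).preimage_mem_nhds (φ.open_target.mem_nhds hts)
    have h3 : ∀ᶠ z in 𝓝 (f x), f (g z) ∈ c'.source := by
      have : Tendsto g (𝓝 (f x)) (𝓝 x) := by simpa only [hgx] using hg.continuousAt.tendsto
      exact this.eventually hfx
    filter_upwards [h1, h2, h3] with z hz1 hz2 hz3
    refine c'.injOn hz3 hz1 ?_
    have : φ (φ.symm (c' z)) = c' z := φ.right_inv hz2
    exact this

/-- A continuous map whose composition with an immersion into a vector space is smooth is
itself smooth. -/
theorem ContMDiff.of_comp_immersion [FiniteDimensional ℝ E] [FiniteDimensional ℝ V]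
    {H' E'' : Type*} [NormedAddCommGroup E''] [NormedSpace ℝ E'']
    [TopologicalSpace H'] {I : ModelWithCorners ℝ E'' H'} {P : Type*} [TopologicalSpace P]
    [ChartedSpace H' P] {f : M → V} {g : P → M}
    (hf : ContMDiff 𝓘(ℝ, E) 𝓘(ℝ, V) ∞ f)
    (hinj : ∀ x, Function.Injective (mfderiv 𝓘(ℝ, E) 𝓘(ℝ, V) f x))
    (hg : Continuous g) (hfg : ContMDiff I 𝓘(ℝ, V) ∞ (f ∘ g)) :
    ContMDiff I 𝓘(ℝ, E) ∞ g := by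
  intro y
  let D : E →L[ℝ] V := mfderiv 𝓘(ℝ, E) 𝓘(ℝ, V) f (g y)
  -- A linear left inverse `L` of the differential makes `L ∘ f` a local diffeomorphism at `g y`.
  -- With `k` its local inverse, `g` agrees near `y` with `k ∘ L ∘ f ∘ g`; continuity of `g` keeps
  -- its values where `k` inverts.
  obtain ⟨L₀, hL₀⟩ := (D : E →ₗ[ℝ] V).exists_leftInverse_of_injective
    (LinearMap.ker_eq_bot.2 (hinj (g y)))
  let L : V →L[ℝ] E := L₀.toContinuousLinearMap
  have hL : ContMDiff 𝓘(ℝ, V) 𝓘(ℝ, E) ∞ L := L.contDiff.contMDiff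
  have hLf : HasMFDerivAt 𝓘(ℝ, E) 𝓘(ℝ, E) (L ∘ f) (g y) (L.comp D) :=
    HasMFDerivAt.comp (g y) L.hasMFDerivAt
      ((hf.mdifferentiable (by simp)) (g y)).hasMFDerivAt
  have hLD : L.comp D = ContinuousLinearMap.id ℝ E := by
    ext v; exact LinearMap.congr_fun hL₀ v
  have hbij : Function.Bijective (L.comp D) := by rw [hLD]; exact Function.bijective_id
  obtain ⟨k, hk, -, hk2, -⟩ := ((hL.comp hf).contMDiffAt (x := g y)).exists_local_inverse hLf hbij
  have : ContMDiffAt I 𝓘(ℝ, E) ∞ (k ∘ (L ∘ (f ∘ g))) y :=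
    ContMDiffAt.comp y hk ((hL.comp hfg).contMDiffAt)
  refine this.congr_of_eventuallyEq ?_
  filter_upwards [hg.continuousAt.eventually hk2] with z hz
  exact hz.symm

/-- A submersion has smooth local sections. -/
theorem ContMDiff.exists_local_section [FiniteDimensional ℝ E'] {p : M → N}
    (hp : ContMDiff 𝓘(ℝ, E) 𝓘(ℝ, E') ∞ p) (x : M)
    (hsurj : Function.Surjective (mfderiv 𝓘(ℝ, E) 𝓘(ℝ, E') p x)) :
    ∃ s : N → M, ContMDiffAt 𝓘(ℝ, E') 𝓘(ℝ, E) ∞ s (p x) ∧ ∀ᶠ z in 𝓝 (p x), p (s z) = z := by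
  let c := extChartAt 𝓘(ℝ, E) x
  let D : E →L[ℝ] E' := mfderiv 𝓘(ℝ, E) 𝓘(ℝ, E') p x
  let C : E →L[ℝ] E := mfderiv 𝓘(ℝ, E) 𝓘(ℝ, E) c.symm (c x)
  have hcs : ContMDiffAt 𝓘(ℝ, E) 𝓘(ℝ, E) ∞ c.symm (c x) :=
    (contMDiffOn_extChartAt_symm x).contMDiffAt (extChartAt_target_mem_nhds x)
  have hcx : c.symm (c x) = x := extChartAt_to_inv x
  have hC : Function.Surjective C := by
    have h1 : HasMFDerivAt 𝓘(ℝ, E) 𝓘(ℝ, E) c.symm (c x) C :=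
      (hcs.mdifferentiableAt (by simp)).hasMFDerivAt
    have h2 : MDifferentiableAt 𝓘(ℝ, E) 𝓘(ℝ, E) c x :=
      (contMDiffAt_extChartAt (n := ∞)).mdifferentiableAt (by simp)
    have h3 := (HasMFDerivAt.comp x h1 h2.hasMFDerivAt)
    have h4 : HasMFDerivAt 𝓘(ℝ, E) 𝓘(ℝ, E) (c.symm ∘ c) x (ContinuousLinearMap.id ℝ E) := by
      refine (hasMFDerivAt_id x).congr_of_eventuallyEq ?_
      filter_upwards [extChartAt_source_mem_nhds (I := 𝓘(ℝ, E)) x] with y hy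
      exact c.left_inv hy
    have h5 := hasMFDerivAt_unique h3 h4
    intro v
    exact ⟨_, DFunLike.congr_fun h5 v⟩
  have hDC : Function.Surjective (D.comp C) := hsurj.comp hC
  -- A right inverse of the differential in the chart gives an affine slice `a`. Carried to `M` as
  -- `σ`, it makes the derivative of `p ∘ σ` at `0` the identity; composing `σ` with a local inverse
  -- of `p ∘ σ` gives the section.
  obtain ⟨R₀, hR₀⟩ := ((D.comp C : E →L[ℝ] E') : E →ₗ[ℝ] E').exists_rightInverse_of_surjective
    (LinearMap.range_eq_top.2 hDC)
  let R : E' →L[ℝ] E := R₀.toContinuousLinearMap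
  let a : E' → E := fun v => c x + R v
  have ha : ContMDiff 𝓘(ℝ, E') 𝓘(ℝ, E) ∞ a := (contDiff_const.add R.contDiff).contMDiff
  have ha0 : a 0 = c x := by simp [a]
  have had : HasMFDerivAt 𝓘(ℝ, E') 𝓘(ℝ, E) a 0 R :=
    (R.hasFDerivAt.const_add (c x)).hasMFDerivAt
  let σ : E' → M := c.symm ∘ a
  have hσ : ContMDiffAt 𝓘(ℝ, E') 𝓘(ℝ, E) ∞ σ 0 :=
    ContMDiffAt.comp 0 (by rw [ha0]; exact hcs) ha.contMDiffAt
  have hσ0 : σ 0 = x := by simp only [σ, Function.comp, ha0, hcx]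
  have hσd : HasMFDerivAt 𝓘(ℝ, E') 𝓘(ℝ, E) σ 0 (C.comp R) := by
    refine HasMFDerivAt.comp 0 ?_ had
    rw [ha0]
    exact (hcs.mdifferentiableAt (by simp)).hasMFDerivAt
  have hpσ : HasMFDerivAt 𝓘(ℝ, E') 𝓘(ℝ, E') (p ∘ σ) 0 (D.comp (C.comp R)) := by
    refine HasMFDerivAt.comp 0 ?_ hσd
    rw [hσ0]
    exact ((hp.mdifferentiable (by simp)) x).hasMFDerivAt
  have hid : D.comp (C.comp R) = ContinuousLinearMap.id ℝ E' := by
    ext v; exact LinearMap.congr_fun hR₀ v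
  have hbij : Function.Bijective (D.comp (C.comp R)) := by
    rw [hid]; exact Function.bijective_id
  obtain ⟨k, hk, hk0, -, hk2⟩ := (ContMDiffAt.comp (0 : E')
    hp.contMDiffAt hσ).exists_local_inverse hpσ hbij
  have hpx : (p ∘ σ) 0 = p x := congrArg p hσ0
  rw [hpx] at hk hk0 hk2
  exact ⟨σ ∘ k, ContMDiffAt.comp (p x) (by rw [hk0]; exact hσ) hk, hk2⟩

/-- A map whose composition with a surjective submersion is smooth is itself smooth. -/
theorem ContMDiff.of_comp_submersion [FiniteDimensional ℝ E'] {H' E'' : Type*}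
    [NormedAddCommGroup E''] [NormedSpace ℝ E'']
    [TopologicalSpace H'] {I : ModelWithCorners ℝ E'' H'} {P : Type*} [TopologicalSpace P]
    [ChartedSpace H' P] {p : M → N} {h : N → P} (hs : Function.Surjective p)
    (hp : ContMDiff 𝓘(ℝ, E) 𝓘(ℝ, E') ∞ p)
    (hsurj : ∀ x, Function.Surjective (mfderiv 𝓘(ℝ, E) 𝓘(ℝ, E') p x))
    (hh : ContMDiff 𝓘(ℝ, E) I ∞ (h ∘ p)) :
    ContMDiff 𝓘(ℝ, E') I ∞ h := by
  intro y
  obtain ⟨x, rfl⟩ := hs y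
  obtain ⟨s, hs1, hs2⟩ := hp.exists_local_section x (hsurj x)
  refine (hh.contMDiffAt.comp (p x) hs1).congr_of_eventuallyEq ?_
  filter_upwards [hs2] with z hz
  simp only [Function.comp, hz]

end LocalInverse

/-! ### Uniqueness of smooth structures -/

namespace SmoothStructure

section Uniqueness

variable {X Y Z : Type*}

/-- `f` is smooth with respect to the structures `S` and `T`. -/
def SmoothMap (S : SmoothStructure X) (T : SmoothStructure Y) (f : X → Y) : Prop :=
  letI := S.top
  letI := S.chartedSpace
  letI := T.top
  letI := T.chartedSpace
  ContMDiff 𝓘(ℝ, S.Model) 𝓘(ℝ, T.Model) ∞ f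

theorem SmoothMap.continuous {S : SmoothStructure X} {T : SmoothStructure Y} {f : X → Y}
    (h : S.SmoothMap T f) : @Continuous X Y S.top T.top f := by
  let _ := S.top
  let _ := S.chartedSpace
  let _ := T.top
  let _ := T.chartedSpace
  exact ContMDiff.continuous h

theorem SmoothMap.comp {S : SmoothStructure X} {T : SmoothStructure Y} {U : SmoothStructure Z}
    {g : Y → Z} {f : X → Y} (hg : T.SmoothMap U g) (hf : S.SmoothMap T f) :
    S.SmoothMap U (g ∘ f) := by
  let _ := S.top
  let _ := S.chartedSpace
  let _ := T.top
  let _ := T.chartedSpace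
  let _ := U.top
  let _ := U.chartedSpace
  exact ContMDiff.comp hg hf

/-- A smooth map is smooth when read in any two charts. -/
theorem SmoothMap.contDiffOn {S : SmoothStructure X} {T : SmoothStructure Y} {f : X → Y}
    (h : S.SmoothMap T f) :
    letI := S.top
    letI := T.top
    ∀ e ∈ S.atlas, ∀ e' ∈ T.atlas,
      ContDiffOn ℝ ∞ (e' ∘ f ∘ e.symm) (e.target ∩ e.symm ⁻¹' (f ⁻¹' e'.source)) := by
  let _ := S.top
  let _ := S.chartedSpace
  let _ := T.top
  let _ := T.chartedSpace
  have := S.isManifold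
  have := T.isManifold
  intro e (he : e ∈ _root_.atlas S.Model X) e' (he' : e' ∈ _root_.atlas T.Model Y)
  have h1 := contMDiffOn_symm_of_mem_maximalAtlas (I := 𝓘(ℝ, S.Model)) (n := ∞)
    (StructureGroupoid.subset_maximalAtlas _ he)
  have h2 := contMDiffOn_of_mem_maximalAtlas (I := 𝓘(ℝ, T.Model)) (n := ∞)
    (StructureGroupoid.subset_maximalAtlas _ he')
  rw [← contMDiffOn_iff_contDiffOn]
  exact h2.comp ((ContMDiff.contMDiffOn (s := univ) h).comp
    (h1.mono inter_subset_left) (fun _ _ => mem_univ _)) (fun _ hx => hx.2)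

/-- The dimensions of diffeomorphic manifolds agree. -/
theorem dim_eq_of_smoothMap [Nonempty X] {S : SmoothStructure X} {T : SmoothStructure Y}
    (f : X ≃ Y) (h : S.SmoothMap T f) (h' : T.SmoothMap S f.symm) : S.dim = T.dim := by
  let _ := S.top
  let _ := S.chartedSpace
  let _ := T.top
  let _ := T.chartedSpace
  let Φ : Diffeomorph 𝓘(ℝ, S.Model) 𝓘(ℝ, T.Model) X Y ∞ := ⟨f, h, h'⟩
  have e : S.Model ≃L[ℝ] T.Model :=
    Φ.mfderivToContinuousLinearEquiv (by simp) (Classical.arbitrary X)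
  simpa using e.toLinearEquiv.finrank_eq

theorem mem_contDiffGroupoid_of_contDiffOn {E : Type*} [NormedAddCommGroup E] [NormedSpace ℝ E]
    {e : OpenPartialHomeomorph E E} (h : ContDiffOn ℝ ∞ e e.source)
    (h' : ContDiffOn ℝ ∞ e.symm e.target) : e ∈ contDiffGroupoid ∞ 𝓘(ℝ, E) := by
  rw [contDiffGroupoid, mem_groupoid_of_pregroupoid]
  simpa [contDiffPregroupoid] using ⟨h, h'⟩

/-- A smooth structure is determined by its smooth maps. -/
theorem eq_of_smoothMap_id [Nonempty X] {S T : SmoothStructure X} (h : S.SmoothMap T id)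
    (h' : T.SmoothMap S id) : S = T := by
  have hdim : S.dim = T.dim := dim_eq_of_smoothMap (Equiv.refl X) h h'
  have htop : S.top = T.top :=
    le_antisymm (continuous_id_iff_le.1 h.continuous) (continuous_id_iff_le.1 h'.continuous)
  have H := h.contDiffOn
  have H' := h'.contDiffOn
  clear h h'
  obtain ⟨n, hS1, hS2, A, hS3, hS4, hS5⟩ := S
  obtain ⟨m, hT1, hT2, B, hT3, hT4, hT5⟩ := T
  dsimp only at hdim htop H H'
  subst hdim htop
  -- Only the atlases can still differ. Smoothness of the identity both ways says that every chart
  -- of one is compatible with all charts of the other, and maximality then puts it in the other.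
  congr 1
  ext e
  constructor
  · intro he
    refine hT5 e fun e' he' => ⟨?_, ?_⟩
    · exact mem_contDiffGroupoid_of_contDiffOn (H e he e' he') (H' e' he' e he)
    · exact mem_contDiffGroupoid_of_contDiffOn (H' e' he' e he) (H e he e' he')
  · intro he
    refine hS5 e fun e' he' => ⟨?_, ?_⟩
    · exact mem_contDiffGroupoid_of_contDiffOn (H' e he e' he') (H e' he' e he)
    · exact mem_contDiffGroupoid_of_contDiffOn (H e' he' e he) (H' e he e' he')

/-- Continuity of `k` comes from the topology of `Y` being induced by `g`, and smoothness from `g`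
being an immersion. -/
theorem IsEmbeddingInto.smoothMap_id {V : Type*} [NormedAddCommGroup V] [NormedSpace ℝ V]
    [FiniteDimensional ℝ V] {S : SmoothStructure X} {T : SmoothStructure Y} {f : X → V}
    {g : Y → V} {k : X → Y} (hk : g ∘ k = f)
    (hS : S.IsEmbeddingInto f) (hT : T.IsEmbeddingInto g) : S.SmoothMap T k := by
  let _ := S.top
  let _ := S.chartedSpace
  let _ := T.top
  let _ := T.chartedSpace
  have := S.isManifold
  have := T.isManifold
  subst hk
  obtain ⟨h1, h2, -⟩ := hS
  obtain ⟨h1', h2', h3'⟩ := hT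
  exact ContMDiff.of_comp_immersion h2' h3' (h1'.continuous_iff.2 h1.continuous) h2

/-- At most one structure makes a given injection an embedding. -/
theorem IsEmbeddingInto.unique [Nonempty X] {V : Type*} [NormedAddCommGroup V] [NormedSpace ℝ V]
    [FiniteDimensional ℝ V] {S T : SmoothStructure X} {f : X → V}
    (hS : S.IsEmbeddingInto f) (hT : T.IsEmbeddingInto f) : S = T :=
  eq_of_smoothMap_id (hS.smoothMap_id rfl hT) (hT.smoothMap_id rfl hS)

theorem IsSurjectiveSubmersion.smoothMap {S : SmoothStructure X} {T : SmoothStructure Y}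
    {p : X → Y} (hp : S.IsSurjectiveSubmersion T p) : S.SmoothMap T p := hp.2.1

theorem IsSurjectiveSubmersion.smoothMap_of_comp {S : SmoothStructure X} {T : SmoothStructure Y}
    {U : SmoothStructure Z} {p : X → Y} {h : Y → Z} (hp : S.IsSurjectiveSubmersion T p)
    (hh : S.SmoothMap U (h ∘ p)) : T.SmoothMap U h := by
  let _ := S.top
  let _ := S.chartedSpace
  let _ := T.top
  let _ := T.chartedSpace
  let _ := U.top
  let _ := U.chartedSpace
  have := S.isManifold
  have := T.isManifold
  have := U.isManifold
  obtain ⟨h1, h2, h3⟩ := hp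
  exact ContMDiff.of_comp_submersion h1 h2 h3 hh

/-- At most one structure on the target makes a given surjection a submersion. -/
theorem IsSurjectiveSubmersion.unique [Nonempty Y] {S : SmoothStructure X}
    {T U : SmoothStructure Y} {p : X → Y} (hT : S.IsSurjectiveSubmersion T p)
    (hU : S.IsSurjectiveSubmersion U p) : T = U :=
  eq_of_smoothMap_id (hT.smoothMap_of_comp hU.smoothMap) (hU.smoothMap_of_comp hT.smoothMap)

theorem isDiffeomorphism_iff {S : SmoothStructure X} {T : SmoothStructure Y} {f : X ≃ Y} :
    S.IsDiffeomorphism T f ↔ S.SmoothMap T f ∧ T.SmoothMap S f.symm := by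
  let _ := S.top
  let _ := S.chartedSpace
  let _ := T.top
  let _ := T.chartedSpace
  constructor
  · rintro ⟨Φ, hΦ⟩
    have h1 : (Φ : X → Y) = f := funext hΦ
    have h2 : (Φ.symm : Y → X) = f.symm := by
      funext y
      rw [Equiv.eq_symm_apply, ← hΦ, Φ.apply_symm_apply]
    exact ⟨h1 ▸ Φ.contMDiff, h2 ▸ Φ.symm.contMDiff⟩
  · rintro ⟨h1, h2⟩
    exact ⟨⟨f, h1, h2⟩, fun _ => rfl⟩

/-- At most one structure on the target makes a given bijection a diffeomorphism. -/
theorem IsDiffeomorphism.unique [Nonempty Y] {S : SmoothStructure X} {T U : SmoothStructure Y}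
    {f : X ≃ Y} (hT : S.IsDiffeomorphism T f) (hU : S.IsDiffeomorphism U f) : T = U := by
  rw [isDiffeomorphism_iff] at hT hU
  refine eq_of_smoothMap_id ?_ ?_
  · simpa using hU.1.comp hT.2
  · simpa using hT.1.comp hU.2

end Uniqueness

/-! ### Transport of a smooth structure along a bijection -/

section Pullback

variable {X : Type*} {E H : Type*} [NormedAddCommGroup E] [NormedSpace ℝ E]
  [TopologicalSpace H] (I : ModelWithCorners ℝ E H)
  {M : Type*} [TopologicalSpace M] [ChartedSpace H M]

/-- `e` is a diffeomorphism onto its image when `X` is identified with the manifold `M`. -/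
def IsPullbackChart [TopologicalSpace X] (f : X ≃ M)
    (e : OpenPartialHomeomorph X (EuclideanSpace ℝ (Fin (Module.finrank ℝ E)))) : Prop :=
  ContMDiffOn I 𝓘(ℝ, EuclideanSpace ℝ (Fin (Module.finrank ℝ E))) ∞ (e ∘ f.symm)
    (f.symm ⁻¹' e.source) ∧
  ContMDiffOn 𝓘(ℝ, EuclideanSpace ℝ (Fin (Module.finrank ℝ E))) I ∞ (f ∘ e.symm) e.target

variable {I}

theorem IsPullbackChart.compatible [TopologicalSpace X] {f : X ≃ M}
    {e e' : OpenPartialHomeomorph X (EuclideanSpace ℝ (Fin (Module.finrank ℝ E)))}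
    (he : IsPullbackChart I f e) (he' : IsPullbackChart I f e') :
    e.symm ≫ₕ e' ∈
      contDiffGroupoid ∞ 𝓘(ℝ, EuclideanSpace ℝ (Fin (Module.finrank ℝ E))) := by
  refine mem_contDiffGroupoid_of_contDiffOn ?_ ?_
  · rw [← contMDiffOn_iff_contDiffOn]
    refine (he'.1.comp (he.2.mono inter_subset_left) fun x hx => ?_).congr fun x hx => ?_
    · simpa using hx.2
    · simp
  · rw [← contMDiffOn_iff_contDiffOn]
    have : (e.symm ≫ₕ e').target ⊆ e'.target := fun x hx => hx.1
    refine (he.1.comp (he'.2.mono this) fun x hx => ?_).congr fun x hx => ?_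
    · simpa using hx.2
    · simp

variable [FiniteDimensional ℝ E] [I.Boundaryless] [IsManifold I ∞ M]

theorem exists_isPullbackChart [TopologicalSpace X] (F : X ≃ₜ M) (x : X) :
    ∃ e, IsPullbackChart I F.toEquiv e ∧ x ∈ e.source := by
  let L : E ≃L[ℝ] EuclideanSpace ℝ (Fin (Module.finrank ℝ E)) := toEuclidean
  let c := extChartAt I (F x)
  refine ⟨F.toOpenPartialHomeomorph ≫ₕ (chartAt H (F x) ≫ₕ
    (I.toHomeomorph.toOpenPartialHomeomorph ≫ₕ L.toHomeomorph.toOpenPartialHomeomorph)),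
    ⟨?_, ?_⟩, ?_⟩
  · have : ContMDiffOn I 𝓘(ℝ, EuclideanSpace ℝ (Fin (Module.finrank ℝ E))) ∞ (L ∘ c)
        (chartAt H (F x)).source :=
      L.contDiff.contMDiff.comp_contMDiffOn contMDiffOn_extChartAt
    refine (this.mono fun y hy => ?_).congr fun y hy => ?_
    · simpa using hy
    · simp [c]
  · have h1 : ContMDiffOn 𝓘(ℝ, E) I ∞ c.symm c.target := contMDiffOn_extChartAt_symm _
    have h2 := h1.comp (L.symm.contDiff.contMDiff.contMDiffOn (s := L.symm ⁻¹' c.target))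
      (fun _ h => h)
    refine (h2.mono fun y hy => ?_).congr fun y hy => ?_
    · simpa [c, extChartAt_target, I.range_eq_univ] using hy
    · simp [c]
  · simp

/-- This gives maximality of the transported atlas: near each point `e` factors through a pullback
chart `e'` by a transition map, which is smooth by hypothesis. -/
theorem isPullbackChart_of_compatible [TopologicalSpace X] (F : X ≃ₜ M)
    {e : OpenPartialHomeomorph X (EuclideanSpace ℝ (Fin (Module.finrank ℝ E)))}
    (h : ∀ e', IsPullbackChart I F.toEquiv e' →
      e.symm ≫ₕ e' ∈ contDiffGroupoid ∞ 𝓘(ℝ, EuclideanSpace ℝ (Fin (Module.finrank ℝ E))) ∧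
      e'.symm ≫ₕ e ∈ contDiffGroupoid ∞ 𝓘(ℝ, EuclideanSpace ℝ (Fin (Module.finrank ℝ E)))) :
    IsPullbackChart I F.toEquiv e := by
  constructor
  · intro y hy
    obtain ⟨e', he', hx⟩ := exists_isPullbackChart (I := I) F (F.symm y)
    have hmem : e' (F.symm y) ∈ (e'.symm ≫ₕ e).source := by
      refine ⟨e'.map_source hx, ?_⟩
      change e'.symm (e' (F.symm y)) ∈ e.source
      rw [e'.left_inv hx]
      exact hy
    have h1 := (contMDiffOn_of_mem_contDiffGroupoid (h e' he').2).contMDiffAt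
      ((e'.symm ≫ₕ e).open_source.mem_nhds hmem)
    have hnhds : ∀ᶠ z in 𝓝 y, F.symm z ∈ e'.source :=
      F.symm.continuous.continuousAt.preimage_mem_nhds (e'.open_source.mem_nhds hx)
    have h2 := he'.1.contMDiffAt hnhds
    refine ((h1.comp y h2).congr_of_eventuallyEq ?_).contMDiffWithinAt
    filter_upwards [hnhds] with z hz
    change e (F.symm z) = e (e'.symm (e' (F.symm z)))
    rw [e'.left_inv hz]
  · intro v hv
    obtain ⟨e', he', hx⟩ := exists_isPullbackChart (I := I) F (e.symm v)
    have hmem : v ∈ (e.symm ≫ₕ e').source := ⟨hv, hx⟩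
    have h1 := (contMDiffOn_of_mem_contDiffGroupoid (h e' he').1).contMDiffAt
      ((e.symm ≫ₕ e').open_source.mem_nhds hmem)
    have h2 := he'.2.contMDiffAt (e'.open_target.mem_nhds (e'.map_source hx))
    refine ((ContMDiffAt.comp v h2 h1).congr_of_eventuallyEq ?_).contMDiffWithinAt
    filter_upwards [(e.symm ≫ₕ e').open_source.mem_nhds hmem] with z hz
    change F (e.symm z) = F (e'.symm (e' (e.symm z)))
    exact congrArg F (e'.left_inv hz.2).symm

variable (I)

/-- A bijection becomes a homeomorphism when its source carries the induced topology. -/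
def inducedHomeomorph (f : X ≃ M) :
    letI : TopologicalSpace X := TopologicalSpace.induced f inferInstance
    X ≃ₜ M :=
  letI : TopologicalSpace X := TopologicalSpace.induced f inferInstance
  { f with
    continuous_toFun := continuous_induced_dom
    continuous_invFun := continuous_induced_rng.2 <| by
      change Continuous (f ∘ f.symm)
      rw [f.self_comp_symm]
      exact continuous_id }

variable [T2Space M] [SecondCountableTopology M]

/-- The smooth structure on `X` that makes the bijection `f` onto the manifold `M` a
diffeomorphism. -/
noncomputable def ofEquiv (f : X ≃ M) : SmoothStructure X :=
  letI top : TopologicalSpace X := TopologicalSpace.induced f inferInstance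
  { dim := Module.finrank ℝ E
    top := top
    t2 := (inducedHomeomorph f).symm.t2Space
    secondCountable := (inducedHomeomorph f).isEmbedding.isInducing.secondCountableTopology
    atlas := {e | IsPullbackChart I f e}
    cover := exists_isPullbackChart (inducedHomeomorph f)
    compatible := fun _ he _ he' => he.compatible he'
    maximal := fun _ h => isPullbackChart_of_compatible (inducedHomeomorph f) h }

@[simp]
theorem dim_ofEquiv (f : X ≃ M) : (ofEquiv I f).dim = Module.finrank ℝ E := rfl

theorem contMDiff_ofEquiv (f : X ≃ M) :
    letI := (ofEquiv I f).top
    letI := (ofEquiv I f).chartedSpace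
    ContMDiff 𝓘(ℝ, (ofEquiv I f).Model) I ∞ f := by
  let S := ofEquiv I f
  let _ := S.top
  let _ := S.chartedSpace
  have := S.isManifold
  intro x
  obtain ⟨e, he, hx⟩ := S.cover x
  have he0 : IsPullbackChart I f e := he
  have he : e ∈ _root_.atlas S.Model X := he
  have h1 := (contMDiffOn_of_mem_maximalAtlas (I := 𝓘(ℝ, S.Model)) (n := ∞)
    (StructureGroupoid.subset_maximalAtlas _ he)).contMDiffAt (e.open_source.mem_nhds hx)
  have h2 := he0.2.contMDiffAt (e.open_target.mem_nhds (e.map_source hx))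
  refine (ContMDiffAt.comp x h2 h1).congr_of_eventuallyEq ?_
  filter_upwards [e.open_source.mem_nhds hx] with z hz
  exact congrArg f (e.left_inv hz).symm

theorem contMDiff_ofEquiv_symm (f : X ≃ M) :
    letI := (ofEquiv I f).top
    letI := (ofEquiv I f).chartedSpace
    ContMDiff I 𝓘(ℝ, (ofEquiv I f).Model) ∞ f.symm := by
  let S := ofEquiv I f
  let _ := S.top
  let _ := S.chartedSpace
  have := S.isManifold
  intro y
  obtain ⟨e, he, hx⟩ := S.cover (f.symm y)
  have he0 : IsPullbackChart I f e := he
  have he : e ∈ _root_.atlas S.Model X := he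
  have hnhds : ∀ᶠ z in 𝓝 y, f.symm z ∈ e.source :=
    (inducedHomeomorph f).symm.continuous.continuousAt.preimage_mem_nhds
      (e.open_source.mem_nhds hx)
  have h1 := (contMDiffOn_symm_of_mem_maximalAtlas (I := 𝓘(ℝ, S.Model)) (n := ∞)
    (StructureGroupoid.subset_maximalAtlas _ he)).contMDiffAt
      (e.open_target.mem_nhds (e.map_source hx))
  have h2 := he0.1.contMDiffAt hnhds
  refine (ContMDiffAt.comp y h1 h2).congr_of_eventuallyEq ?_
  filter_upwards [hnhds] with z hz
  exact (e.left_inv hz).symm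

end Pullback

/-- Every smooth structure can be transported along a bijection. -/
theorem exists_isDiffeomorphism {X Y : Type*} (S : SmoothStructure X) (f : X ≃ Y) :
    ∃ T : SmoothStructure Y, S.IsDiffeomorphism T f := by
  let _ := S.top
  let _ := S.chartedSpace
  have := S.isManifold
  have := S.t2
  have := S.secondCountable
  exact ⟨ofEquiv 𝓘(ℝ, S.Model) f.symm, isDiffeomorphism_iff.2
    ⟨contMDiff_ofEquiv_symm 𝓘(ℝ, S.Model) f.symm, contMDiff_ofEquiv 𝓘(ℝ, S.Model) f.symm⟩⟩

end SmoothStructure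

/-! ### Regular products with linear functions -/

section SeriesAlgebra

theorem HasRegularExpansion.eq_regularSeries {f : QBall → ℍ[ℝ]} {a : ℕ → ℍ[ℝ]}
    (ha : HasRegularExpansion f a) : regularSeries a = f :=
  funext fun q => (ha q).tsum_eq

/-- The coefficients of `l_{(a,b)}`. -/
noncomputable def linearCoeff (a b : ℍ[ℝ]) : ℕ → ℍ[ℝ]
  | 0 => b
  | 1 => a
  | _ + 2 => 0

theorem hasRegularExpansion_linearFun (a b : ℍ[ℝ]) :
    HasRegularExpansion (linearFun a b) (linearCoeff a b) := by
  intro q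
  have h : HasSum (fun n => (q : ℍ[ℝ]) ^ n * linearCoeff a b n)
      (∑ n ∈ Finset.range 2, (q : ℍ[ℝ]) ^ n * linearCoeff a b n) := by
    refine hasSum_sum_of_ne_finset_zero fun n hn => ?_
    obtain ⟨k, rfl⟩ : ∃ k, n = k + 2 := ⟨n - 2, by simp at hn; omega⟩
    simp [linearCoeff]
  convert h using 1
  simp [Finset.sum_range_succ, linearCoeff, linearFun, add_comm]

theorem regularConj_linearFun (a b : ℍ[ℝ]) :
    regularConj (linearFun a b) = linearFun (star a) (star b) := by
  rw [regularConj, (hasRegularExpansion_linearFun a b).regularCoeff_eq,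
    ← (hasRegularExpansion_linearFun (star a) (star b)).eq_regularSeries]
  congr 1
  funext n
  match n with
  | 0 => rfl
  | 1 => rfl
  | n + 2 => simp [linearCoeff]

/-- The coefficients of `f * l_{(a,b)}` where `f` has the coefficients `e`. -/
noncomputable def mulLinearCoeff (e : ℕ → ℍ[ℝ]) (a b : ℍ[ℝ]) : ℕ → ℍ[ℝ]
  | 0 => e 0 * b
  | n + 1 => e (n + 1) * b + e n * a

theorem hasSum_mulLinearCoeff {e : ℕ → ℍ[ℝ]} {a b q y : ℍ[ℝ]}
    (h : HasSum (fun n => q ^ n * e n) y) :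
    HasSum (fun n => q ^ n * mulLinearCoeff e a b n) (y * b + q * y * a) := by
  have h1 := h.mul_right b
  have h2 : HasSum (fun n => if n = 0 then 0 else q ^ n * e (n - 1) * a) (q * y * a) := by
    rw [← hasSum_nat_add_iff' 1]
    simpa [pow_succ', mul_assoc] using (h.mul_left q).mul_right a
  refine (h1.add h2).congr_fun fun n => ?_
  match n with
  | 0 => simp [mulLinearCoeff]
  | n + 1 => simp [mulLinearCoeff, mul_add, mul_assoc]

theorem starProd_linearFun_eq {f : QBall → ℍ[ℝ]} {e : ℕ → ℍ[ℝ]} (h : HasRegularExpansion f e)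
    (a b : ℍ[ℝ]) : starProd f (linearFun a b) = regularSeries (mulLinearCoeff e a b) := by
  rw [starProd, h.regularCoeff_eq, (hasRegularExpansion_linearFun a b).regularCoeff_eq]
  congr 1
  funext n
  match n with
  | 0 => simp [linearCoeff, mulLinearCoeff]
  | n + 1 =>
    -- Only `k = n + 1` and `k = n` contribute, since `l_{(a,b)}` has no coefficients beyond order
    -- 1.
    rw [Finset.sum_range_succ, Finset.sum_range_succ, Finset.sum_eq_zero]
    · simp [linearCoeff, mulLinearCoeff, add_comm]
    · intro k hk
      obtain ⟨j, hj⟩ : ∃ j, n + 1 - k = j + 2 :=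
        ⟨n + 1 - k - 2, by have := Finset.mem_range.1 hk; omega⟩
      simp [hj, linearCoeff]

/-- Right multiplication by a linear function has a pointwise formula, which lets values of `𝓕_A` be
computed without summing its series. -/
theorem starProd_linearFun {f : QBall → ℍ[ℝ]} {e : ℕ → ℍ[ℝ]} (h : HasRegularExpansion f e)
    (a b : ℍ[ℝ]) (q : QBall) :
    starProd f (linearFun a b) q = f q * b + q * f q * a := by
  rw [starProd_linearFun_eq h]
  exact (hasSum_mulLinearCoeff (h q)).tsum_eq

theorem HasRegularExpansion.starProd_linearFun {f : QBall → ℍ[ℝ]} {e : ℕ → ℍ[ℝ]}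
    (h : HasRegularExpansion f e) (a b : ℍ[ℝ]) :
    HasRegularExpansion (starProd f (linearFun a b)) (mulLinearCoeff e a b) := by
  intro q
  rw [_root_.starProd_linearFun h]
  exact hasSum_mulLinearCoeff (h q)

end SeriesAlgebra

/-! ### The regular reciprocal of a linear function -/

section Reciprocal

variable {c d : ℍ[ℝ]}

/-- The value of `l_{(c,d)}^s` at `q` in terms of the value of `l_{(c,d)}^c`. It commutes with `q`
because `l_{(c,d)}^s` has real coefficients. -/
theorem symmetrization_linearFun (c d : ℍ[ℝ]) (q : QBall) :
    symmetrization (linearFun c d) q = (q * star c + star d) * d + q * (q * star c + star d) * c ∧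
      Commute (q : ℍ[ℝ]) (symmetrization (linearFun c d) q) := by
  have h0 : symmetrization (linearFun c d) q =
      (d * star d) + q * (c * star d + d * star c) + q * (q * (c * star c)) := by
    rw [symmetrization, regularConj_linearFun,
      starProd_linearFun (hasRegularExpansion_linearFun c d), linearFun]
    noncomm_ring
  -- Both sides are twice the real part of `c * star d`. Since the other two coefficients are
  -- squared norms, all conjugates may be moved to the left.
  have h1 : c * star d + d * star c = star c * d + star d * c := by
    ext <;> simp <;> ring
  have h2 : ∃ t : ℝ, c * star d + d * star c = t := by
    refine ⟨2 * (c * star d).re, ?_⟩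
    ext <;> simp <;> ring
  constructor
  · rw [h0, h1, Quaternion.self_mul_star, Quaternion.self_mul_star, ← Quaternion.star_mul_self,
      ← Quaternion.star_mul_self]
    noncomm_ring
  · rw [h0, Quaternion.self_mul_star, Quaternion.self_mul_star]
    obtain ⟨t, ht⟩ := h2
    rw [ht]
    have hc : ∀ t : ℝ, Commute (q : ℍ[ℝ]) t := fun t => (Quaternion.coe_commutes t _).symm
    have hq : Commute (q : ℍ[ℝ]) q := Commute.refl _
    exact ((hc _).add_right (hq.mul_right (hc _))).add_right
      (hq.mul_right (hq.mul_right (hc _)))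

theorem linear_ne_zero {p : ℍ[ℝ]} (h : ‖c‖ < ‖d‖) (hp : ‖p‖ < 1) : d + p * c ≠ 0 := by
  intro h0
  have h1 : ‖d‖ = ‖p‖ * ‖c‖ := by
    rw [← norm_mul, ← norm_neg (p * c), ← eq_neg_of_add_eq_zero_left h0]
  nlinarith [norm_nonneg c, norm_nonneg p]

/-- The value of `l_{(c,d)}^{-*}` at `q` is the value of `l_{(c,d)}⁻¹` at a conjugate of `q`. -/
theorem exists_regularReciprocal_linearFun (h : ‖c‖ < ‖d‖) (q : QBall) :
    ∃ p : ℍ[ℝ], ‖p‖ = ‖(q : ℍ[ℝ])‖ ∧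
      regularReciprocal (linearFun c d) q = (d + p * c)⁻¹ ∧
      q * regularReciprocal (linearFun c d) q = regularReciprocal (linearFun c d) q * p := by
  have hq : ‖(q : ℍ[ℝ])‖ < 1 := mem_ball_zero_iff.1 q.2
  set w : ℍ[ℝ] := q * star c + star d with hw
  have hw0 : w ≠ 0 := by
    rw [hw, add_comm]
    exact linear_ne_zero (by simpa using h) hq
  obtain ⟨h1, h2⟩ := symmetrization_linearFun c d q
  rw [← hw] at h1
  have hE : regularReciprocal (linearFun c d) q = (symmetrization (linearFun c d) q)⁻¹ * w := by
    rw [regularReciprocal, regularConj_linearFun, linearFun]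
  -- The conjugate sought is `p = w⁻¹ q w`. It turns the symmetrization into `w (d + p c)`, from
  -- which the factor `w` of the reciprocal cancels.
  have hwp : w * (w⁻¹ * q * w) = q * w := by
    rw [mul_assoc, mul_inv_cancel_left₀ hw0]
  refine ⟨w⁻¹ * q * w, ?_, ?_, ?_⟩
  · rw [norm_mul, norm_mul, norm_inv]
    field_simp
  · have : symmetrization (linearFun c d) q = w * (d + w⁻¹ * q * w * c) := by
      rw [h1, mul_add w, ← mul_assoc w _ c, hwp]
    rw [hE, this, mul_inv_rev, mul_assoc, inv_mul_cancel₀ hw0, mul_one]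
  · rw [hE, ← mul_assoc, h2.inv_right₀.eq, mul_assoc, mul_assoc, hwp]

/-- The coefficients of `l_{(c,d)}^{-*}`. -/
noncomputable def reciprocalCoeff (c d : ℍ[ℝ]) (n : ℕ) : ℍ[ℝ] := d⁻¹ * (-(c * d⁻¹)) ^ n

/-- The geometric-type series and the pointwise reciprocal both solve `y = d⁻¹ + q y r` with `r =
-(c d⁻¹)`. As `|q||r| < 1`, this equation has at most one solution. -/
theorem hasRegularExpansion_regularReciprocal (h : ‖c‖ < ‖d‖) :
    HasRegularExpansion (regularReciprocal (linearFun c d)) (reciprocalCoeff c d) := by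
  intro q
  have hq : ‖(q : ℍ[ℝ])‖ < 1 := mem_ball_zero_iff.1 q.2
  have hd : d ≠ 0 := norm_pos_iff.1 ((norm_nonneg c).trans_lt h)
  set r : ℍ[ℝ] := -(c * d⁻¹) with hr
  have hr1 : ‖r‖ < 1 := by
    rw [hr, norm_neg, norm_mul, norm_inv, ← div_eq_mul_inv, div_lt_one (norm_pos_iff.2 hd)]
    exact h
  have hqr : ‖(q : ℍ[ℝ])‖ * ‖r‖ < 1 := by
    nlinarith [norm_nonneg (q : ℍ[ℝ]), norm_nonneg r]
  have hs : Summable fun n => (q : ℍ[ℝ]) ^ n * reciprocalCoeff c d n := by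
    refine Summable.of_norm_bounded (g := fun n => ‖d⁻¹‖ * (‖(q : ℍ[ℝ])‖ * ‖r‖) ^ n)
      ((summable_geometric_of_lt_one (by positivity) hqr).mul_left _) fun n => ?_
    rw [reciprocalCoeff, ← hr, norm_mul, norm_mul, norm_pow, norm_pow, mul_pow]
    apply le_of_eq
    ring
  obtain ⟨y, hy⟩ := hs
  have hy2 : y = d⁻¹ + q * y * r := by
    refine hy.unique ?_
    rw [← hasSum_nat_add_iff' 1]
    have h3 := (hy.mul_left (q : ℍ[ℝ])).mul_right r
    simpa [reciprocalCoeff, ← hr, pow_succ' (q : ℍ[ℝ]), pow_succ r, mul_assoc] using h3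
  obtain ⟨p, hp, h1, h2⟩ := exists_regularReciprocal_linearFun h q
  set E := regularReciprocal (linearFun c d) q
  have hE : E = d⁻¹ + q * E * r := by
    have h0 : d + p * c ≠ 0 := linear_ne_zero h (hp ▸ hq)
    have h4 : E * d + q * E * c = 1 := by
      rw [h2, mul_assoc, ← mul_add, h1, inv_mul_cancel₀ h0]
    have h5 : E * d = 1 - q * E * c := eq_sub_of_add_eq h4
    calc E = E * d * d⁻¹ := by rw [mul_assoc, mul_inv_cancel₀ hd, mul_one]
      _ = d⁻¹ + q * E * r := by rw [h5, hr]; noncomm_ring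
  have hD : E - y = q * (E - y) * r := by
    conv_lhs => rw [hE, hy2]
    noncomm_ring
  have hn : ‖E - y‖ = ‖E - y‖ * (‖(q : ℍ[ℝ])‖ * ‖r‖) := by
    conv_lhs => rw [hD]
    rw [norm_mul, norm_mul]
    ring
  have : E = y := by
    rw [← sub_eq_zero, ← norm_eq_zero]
    nlinarith [norm_nonneg (E - y)]
  rw [this]
  exact hy

end Reciprocal

/-! ### Regular Möbius maps: the ball is preserved, and the fibres are cosets -/

section Mobius

/-- These row relations come from `A A⁻¹ = 1`; the column relations below come from the defining
equation. -/
theorem Sp11.mul_star_rel (A : Sp11) :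
    A.1 0 0 * star (A.1 0 0) = 1 + A.1 0 1 * star (A.1 0 1) ∧
    A.1 0 0 * star (A.1 1 0) = A.1 0 1 * star (A.1 1 1) ∧
    A.1 1 1 * star (A.1 1 1) = 1 + A.1 1 0 * star (A.1 1 0) := by
  have h : A.1 * (I11 * A.1ᴴ * I11) = 1 := congrArg Subtype.val (mul_inv_cancel A)
  have h00 := congrFun (congrFun h 0) 0
  have h10 := congrFun (congrFun h 0) 1
  have h11 := congrFun (congrFun h 1) 1
  simp [I11, Matrix.mul_apply, Fin.sum_univ_two, Matrix.vecMul,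
    Matrix.conjTranspose_apply, dotProduct] at h00 h10 h11
  refine ⟨?_, ?_, ?_⟩
  · rw [← h00]; abel
  · rw [← sub_eq_zero, ← neg_eq_zero, ← h10]; abel
  · rw [← h11]; abel

theorem Sp11.star_mul_rel (A : Sp11) :
    star (A.1 0 0) * A.1 0 0 = 1 + star (A.1 1 0) * A.1 1 0 ∧
    star (A.1 0 0) * A.1 0 1 = star (A.1 1 0) * A.1 1 1 ∧
    star (A.1 1 1) * A.1 1 1 = 1 + star (A.1 0 1) * A.1 0 1 := by
  have h := mem_Sp11.1 A.2
  have h00 := congrFun (congrFun h 0) 0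
  have h01 := congrFun (congrFun h 0) 1
  have h11 := congrFun (congrFun h 1) 1
  simp [I11, Matrix.mul_apply, Fin.sum_univ_two, Matrix.conjTranspose_apply] at h00 h01 h11
  refine ⟨?_, ?_, ?_⟩
  · rw [← h00]; abel
  · rw [← sub_eq_zero, ← h01]; abel
  · rw [← neg_eq_iff_eq_neg] at h11; rw [← h11]; abel

theorem norm_sq_eq_of_star_mul {x y : ℍ[ℝ]} (h : star x * x = 1 + star y * y) :
    ‖x‖ ^ 2 = 1 + ‖y‖ ^ 2 := by
  rw [Quaternion.star_mul_self, Quaternion.star_mul_self, Quaternion.normSq_eq_norm_mul_self,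
    Quaternion.normSq_eq_norm_mul_self] at h
  have := congrArg QuaternionAlgebra.re h
  simp at this
  linarith

theorem norm_sq_eq_of_mul_star {x y : ℍ[ℝ]} (h : x * star x = 1 + y * star y) :
    ‖x‖ ^ 2 = 1 + ‖y‖ ^ 2 := by
  simpa using norm_sq_eq_of_star_mul (x := star x) (y := star y) (by simpa using h)

theorem norm_lt_of_sq {x y : ℝ} (hy : 0 ≤ y) (h : y ^ 2 = 1 + x ^ 2) : x < y := by
  nlinarith

theorem Sp11.norm_01_lt_11 (A : Sp11) : ‖A.1 0 1‖ < ‖A.1 1 1‖ :=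
  norm_lt_of_sq (norm_nonneg _) (norm_sq_eq_of_star_mul (Sp11.star_mul_rel A).2.2)

theorem Sp11.ne_zero_11 (A : Sp11) : A.1 1 1 ≠ 0 :=
  norm_pos_iff.1 ((norm_nonneg _).trans_lt (Sp11.norm_01_lt_11 A))

theorem hasRegularExpansion_regularMobius (A : Sp11) :
    HasRegularExpansion (regularMobius A)
      (mulLinearCoeff (reciprocalCoeff (A.1 0 1) (A.1 1 1)) (A.1 0 0) (A.1 1 0)) :=
  (hasRegularExpansion_regularReciprocal (Sp11.norm_01_lt_11 A)).starProd_linearFun _ _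

theorem norm_regularMobius_lt_one (A : Sp11) (q : QBall) : ‖regularMobius A q‖ < 1 := by
  have hq : ‖(q : ℍ[ℝ])‖ < 1 := mem_ball_zero_iff.1 q.2
  obtain ⟨p, hp, h1, h2⟩ := exists_regularReciprocal_linearFun (Sp11.norm_01_lt_11 A) q
  obtain ⟨r1, r2, r3⟩ := (Sp11.mul_star_rel A)
  rw [regularMobius, starProd_linearFun (hasRegularExpansion_regularReciprocal (Sp11.norm_01_lt_11 A)),
    h2, mul_assoc, ← mul_add, h1, norm_mul, norm_inv]
  have h0 := linear_ne_zero (Sp11.norm_01_lt_11 A) (hp ▸ hq)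
  generalize A.1 0 0 = a at *
  generalize A.1 0 1 = c at *
  generalize A.1 1 0 = b at *
  generalize A.1 1 1 = d at *
  -- This is the identity `|d + pc|² + |p|² = 1 + |b + pa|²`, obtained by expanding and substituting
  -- the row relations.
  have key : (d + p * c) * star (d + p * c) + p * star p =
      1 + (b + p * a) * star (b + p * a) := by
    have r2' : b * star a = d * star c := by simpa using congrArg star r2
    simp only [star_add, star_mul, mul_add, add_mul]
    have e1 : p * a * (star a * star p) = p * (a * star a) * star p := by noncomm_ring
    have e2 : p * a * star b = p * (a * star b) := by noncomm_ring
    have e3 : b * (star a * star p) = (b * star a) * star p := by noncomm_ring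
    rw [e1, e2, e3, r1, r2, r2', r3]
    noncomm_ring
  simp only [Quaternion.self_mul_star, Quaternion.normSq_eq_norm_mul_self] at key
  have key := congrArg QuaternionAlgebra.re key
  simp at key
  rw [← div_eq_inv_mul, div_lt_one (norm_pos_iff.2 h0)]
  have : ‖p‖ < 1 := hp ▸ hq
  nlinarith [norm_nonneg p, norm_nonneg (d + p * c)]

theorem mem_Sp1I2_iff {A B : Sp11} :
    B * A⁻¹ ∈ Sp1I2 ↔ ∃ u : ℍ[ℝ], ‖u‖ = 1 ∧ ∀ i j, B.1 i j = u * A.1 i j := by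
  have h : ∀ u : ℍ[ℝ], (B * A⁻¹).1 = Matrix.diagonal (fun _ => u) ↔
      ∀ i j, B.1 i j = u * A.1 i j := by
    intro u
    have h1 : (B * A⁻¹).1 * A.1 = B.1 := by
      rw [← Submonoid.coe_mul, inv_mul_cancel_right]
    have h2 : A.1 * (A⁻¹).1 = 1 := congrArg Subtype.val (mul_inv_cancel A)
    constructor
    · intro hu i j
      rw [← h1, hu, Matrix.diagonal_mul]
    · intro hu
      have : B.1 = Matrix.diagonal (fun _ => u) * A.1 := by
        ext i j : 1
        rw [Matrix.diagonal_mul, hu]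
      rw [Submonoid.coe_mul, this, mul_assoc, h2, mul_one]
  exact exists_congr fun u => and_congr_right fun _ => h u

/-- With `m = d⁻¹a - d⁻¹c d⁻¹b`, the coefficients of orders 0, 1, 2 are `d⁻¹b`, `m` and `-d⁻¹c m`.
Since `m ≠ 0`, they determine `d⁻¹c`, hence also `d⁻¹a`. -/
theorem exists_unit_of_mulLinearCoeff_eq {a b c d a' b' c' d' : ℍ[ℝ]} (hd : d ≠ 0) (hd' : d' ≠ 0)
    (nA : ‖d‖ ^ 2 = 1 + ‖c‖ ^ 2) (nB : ‖d'‖ ^ 2 = 1 + ‖c'‖ ^ 2) (hbd : ‖b‖ ≤ ‖d‖)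
    (hca : ‖c‖ < ‖a‖)
    (h : mulLinearCoeff (reciprocalCoeff c d) a b = mulLinearCoeff (reciprocalCoeff c' d') a' b') :
    ∃ u : ℍ[ℝ], ‖u‖ = 1 ∧ a' = u * a ∧ b' = u * b ∧ c' = u * c ∧ d' = u * d := by
  have pA := norm_pos_iff.2 hd
  have pB := norm_pos_iff.2 hd'
  have c0 : ∀ a b c d : ℍ[ℝ], mulLinearCoeff (reciprocalCoeff c d) a b 0 = d⁻¹ * b := by
    intro a b c d
    rw [mulLinearCoeff, reciprocalCoeff, pow_zero, mul_one]
  have c1 : ∀ a b c d : ℍ[ℝ], mulLinearCoeff (reciprocalCoeff c d) a b 1 =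
      d⁻¹ * a - d⁻¹ * c * (d⁻¹ * b) := by
    intro a b c d
    rw [mulLinearCoeff, reciprocalCoeff, reciprocalCoeff, pow_zero, mul_one, zero_add, pow_one]
    noncomm_ring
  have c2 : ∀ a b c d : ℍ[ℝ], mulLinearCoeff (reciprocalCoeff c d) a b 2 =
      -(d⁻¹ * c * (d⁻¹ * a - d⁻¹ * c * (d⁻¹ * b))) := by
    intro a b c d
    rw [mulLinearCoeff, reciprocalCoeff, reciprocalCoeff, pow_succ, pow_one]
    noncomm_ring
  have h0 := congrFun h 0
  have h1 := congrFun h 1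
  have h2 := congrFun h 2
  rw [c0, c0] at h0
  rw [c1, c1] at h1
  rw [c2, c2, ← h1] at h2
  clear c0 c1 c2 h
  -- Otherwise `a = c d⁻¹ b`, so `|a| ≤ |c|`, against `hca`.
  have m : d⁻¹ * a - d⁻¹ * c * (d⁻¹ * b) ≠ 0 := by
    intro hz
    have e : a = c * (d⁻¹ * b) := by
      rw [mul_assoc, ← mul_sub] at hz
      exact sub_eq_zero.1 ((mul_eq_zero.1 hz).resolve_left (inv_ne_zero hd))
    rw [e, norm_mul, norm_mul, norm_inv, ← div_eq_inv_mul] at hca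
    have : ‖b‖ / ‖d‖ ≤ 1 := (div_le_one pA).2 hbd
    nlinarith [norm_nonneg c]
  have hs : d⁻¹ * c = d'⁻¹ * c' := mul_right_cancel₀ m (neg_injective h2)
  have ha : d⁻¹ * a = d'⁻¹ * a' := by
    rw [hs, h0] at h1
    exact sub_left_injective h1
  -- The ratios `|c|/|d|` and `|c'|/|d'|` agree, and `|d|² = 1 + |c|²` makes `|d|` a function of
  -- this ratio.
  have hnorm : ‖d‖ = ‖d'‖ := by
    have hs' := congrArg norm hs
    rw [norm_mul, norm_mul, norm_inv, norm_inv, ← div_eq_inv_mul, ← div_eq_inv_mul,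
      div_eq_div_iff pA.ne' pB.ne'] at hs'
    have hsq := congrArg (· ^ 2) hs'
    simp only [mul_pow] at hsq
    refine (sq_eq_sq₀ pA.le pB.le).1 ?_
    nlinarith
  have e : ∀ x y : ℍ[ℝ], d⁻¹ * x = d'⁻¹ * y → y = d' * d⁻¹ * x := by
    intro x y hxy
    rw [mul_assoc, hxy, mul_inv_cancel_left₀ hd']
  refine ⟨d' * d⁻¹, ?_, e _ _ ha, e _ _ h0, e _ _ hs,
    e _ _ (by rw [inv_mul_cancel₀ hd, inv_mul_cancel₀ hd'])⟩
  rw [norm_mul, norm_inv, hnorm, mul_inv_cancel₀ pB.ne']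

theorem regularMobius_eq_iff {A B : Sp11} :
    regularMobius A = regularMobius B ↔ B * A⁻¹ ∈ Sp1I2 := by
  rw [mem_Sp1I2_iff]
  constructor
  · intro h
    have n1 := norm_sq_eq_of_mul_star (Sp11.mul_star_rel A).1
    have n2 := norm_sq_eq_of_mul_star (Sp11.mul_star_rel A).2.2
    have hB := hasRegularExpansion_regularMobius B
    rw [← h] at hB
    have hAB := (hasRegularExpansion_regularMobius A).unique hB
    obtain ⟨u, hu, h1, h2, h3, h4⟩ := exists_unit_of_mulLinearCoeff_eq
      (Sp11.ne_zero_11 A) (Sp11.ne_zero_11 B)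
      (norm_sq_eq_of_star_mul (Sp11.star_mul_rel A).2.2)
      (norm_sq_eq_of_star_mul (Sp11.star_mul_rel B).2.2)
      (norm_lt_of_sq (norm_nonneg _) n2).le (norm_lt_of_sq (norm_nonneg _) n1) hAB
    refine ⟨u, hu, ?_⟩
    rw [Fin.forall_fin_two, Fin.forall_fin_two, Fin.forall_fin_two]
    exact ⟨⟨h1, h3⟩, h2, h4⟩
  · rintro ⟨u, hu, h⟩
    have hu0 : u ≠ 0 := by rintro rfl; simp at hu
    rw [← (hasRegularExpansion_regularMobius A).eq_regularSeries,
      ← (hasRegularExpansion_regularMobius B).eq_regularSeries]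
    congr 1
    have key : ∀ n x, reciprocalCoeff (B.1 0 1) (B.1 1 1) n * (u * x) =
        reciprocalCoeff (A.1 0 1) (A.1 1 1) n * x := by
      intro n x
      -- The ratio of the geometric series for `B` is the `u`-conjugate of that for `A`, so `u`
      -- passes through its powers and meets the `u⁻¹` in the inverse of `d`.
      have hs : SemiconjBy u (-(A.1 0 1 * (A.1 1 1)⁻¹)) (-(B.1 0 1 * (B.1 1 1)⁻¹)) := by
        rw [SemiconjBy, h, h, mul_inv_rev]
        simp only [mul_neg, neg_mul, mul_assoc, inv_mul_cancel₀ hu0, mul_one]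
      have hp := (hs.pow_right n).eq
      rw [reciprocalCoeff, reciprocalCoeff, mul_assoc, ← mul_assoc _ u, ← hp, h 1 1, mul_inv_rev]
      simp only [mul_assoc, inv_mul_cancel_left₀ hu0]
    funext n
    match n with
    | 0 => simp only [mulLinearCoeff, h 1 0, key]
    | n + 1 => simp only [mulLinearCoeff, h 1 0, h 0 0, key]

end Mobius

/-! ### Global coordinates on `Sp(1,1)` -/

section Coordinates

/-- The unit quaternions. -/
abbrev QSphere : Set ℍ[ℝ] := Metric.sphere (0 : ℍ[ℝ]) 1

instance fact_finrank_quaternion : Fact (Module.finrank ℝ ℍ[ℝ] = 3 + 1) :=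
  ⟨Quaternion.finrank_eq_four⟩

/-- The length `√(1 + |v|²)` of the diagonal entries of a matrix of `Sp(1,1)`. -/
noncomputable def diagNorm (v : ℍ[ℝ]) : ℝ := √(1 + ‖v‖ ^ 2)

theorem diagNorm_pos (v : ℍ[ℝ]) : 0 < diagNorm v := Real.sqrt_pos.2 (by positivity)

theorem diagNorm_sq (v : ℍ[ℝ]) : diagNorm v ^ 2 = 1 + ‖v‖ ^ 2 := Real.sq_sqrt (by positivity)

theorem contDiff_diagNorm : ContDiff ℝ ∞ diagNorm :=
  (contDiff_const.add (contDiff_norm_sq ℝ)).sqrt fun v => by positivity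

theorem star_mul_self_eq_coe_norm_sq (x : ℍ[ℝ]) : star x * x = ((‖x‖ ^ 2 : ℝ) : ℍ[ℝ]) := by
  rw [Quaternion.star_mul_self, Quaternion.normSq_eq_norm_mul_self, pow_two]

theorem mul_star_self_eq_coe_norm_sq (x : ℍ[ℝ]) : x * star x = ((‖x‖ ^ 2 : ℝ) : ℍ[ℝ]) := by
  rw [Quaternion.self_mul_star, Quaternion.normSq_eq_norm_mul_self, pow_two]

theorem QSphere.norm_eq (s : QSphere) : ‖(s : ℍ[ℝ])‖ = 1 := mem_sphere_zero_iff_norm.1 s.2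

theorem QSphere.star_mul (s : QSphere) : star (s : ℍ[ℝ]) * s = 1 := by
  rw [star_mul_self_eq_coe_norm_sq, QSphere.norm_eq]; simp

theorem QSphere.mul_star (s : QSphere) : (s : ℍ[ℝ]) * star (s : ℍ[ℝ]) = 1 := by
  rw [mul_star_self_eq_coe_norm_sq, QSphere.norm_eq]; simp

theorem QSphere.coe_inv (s : QSphere) : ((s⁻¹ : QSphere) : ℍ[ℝ]) = star (s : ℍ[ℝ]) := by
  rw [Metric.unitSphere.coe_inv]
  exact inv_eq_of_mul_eq_one_right (QSphere.mul_star s)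

/-- The matrix entries of the element of `Sp(1,1)` with the coordinates `(v, s, t)`. -/
noncomputable def coordEntries (p : ℍ[ℝ] × ℍ[ℝ] × ℍ[ℝ]) : Fin 2 → Fin 2 → ℍ[ℝ] :=
  ![![diagNorm p.1 • p.2.1, star p.1 * p.2.2], ![p.1 * p.2.1, diagNorm p.1 • p.2.2]]

/-- The coordinates `(v, s, t)` of an element of `Sp(1,1)` in terms of its entries. -/
noncomputable def entryCoords (x : Fin 2 → Fin 2 → ℍ[ℝ]) : ℍ[ℝ] × ℍ[ℝ] × ℍ[ℝ] :=
  ((diagNorm (x 1 0))⁻¹ • (x 1 0 * star (x 0 0)), (diagNorm (x 1 0))⁻¹ • x 0 0,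
    (diagNorm (x 1 0))⁻¹ • x 1 1)

theorem contDiff_quaternion_star : ContDiff ℝ ∞ (star : ℍ[ℝ] → ℍ[ℝ]) :=
  (LinearMap.toContinuousLinearMap
    { toFun := star
      map_add' := star_add
      map_smul' := Quaternion.star_smul : ℍ[ℝ] →ₗ[ℝ] ℍ[ℝ] }).contDiff

theorem contDiff_coordEntries : ContDiff ℝ ∞ coordEntries := by
  have h1 : ContDiff ℝ ∞ fun p : ℍ[ℝ] × ℍ[ℝ] × ℍ[ℝ] => diagNorm p.1 :=
    contDiff_diagNorm.comp contDiff_fst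
  have h2 : ContDiff ℝ ∞ fun p : ℍ[ℝ] × ℍ[ℝ] × ℍ[ℝ] => p.2.1 := contDiff_fst.comp contDiff_snd
  have h3 : ContDiff ℝ ∞ fun p : ℍ[ℝ] × ℍ[ℝ] × ℍ[ℝ] => p.2.2 := contDiff_snd.comp contDiff_snd
  have h4 : ContDiff ℝ ∞ fun p : ℍ[ℝ] × ℍ[ℝ] × ℍ[ℝ] => star p.1 :=
    contDiff_quaternion_star.comp contDiff_fst
  rw [contDiff_pi, Fin.forall_fin_two, contDiff_pi, contDiff_pi, Fin.forall_fin_two,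
    Fin.forall_fin_two]
  exact ⟨⟨h1.smul h2, h4.mul h3⟩, contDiff_fst.mul h2, h1.smul h3⟩

theorem contDiff_entryCoords : ContDiff ℝ ∞ entryCoords := by
  have h : ∀ i j, ContDiff ℝ ∞ fun x : Fin 2 → Fin 2 → ℍ[ℝ] => x i j := fun i j =>
    (contDiff_apply ℝ ℍ[ℝ] j).comp (contDiff_apply ℝ (Fin 2 → ℍ[ℝ]) i)
  have h1 : ContDiff ℝ ∞ fun x : Fin 2 → Fin 2 → ℍ[ℝ] => (diagNorm (x 1 0))⁻¹ :=
    (contDiff_diagNorm.comp (h 1 0)).inv fun x => (diagNorm_pos _).ne'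
  exact (h1.smul ((h 1 0).mul (contDiff_quaternion_star.comp (h 0 0)))).prodMk
    ((h1.smul (h 0 0)).prodMk (h1.smul (h 1 1)))

/-- The inclusion of `ℍ × S³ × S³` into `ℍ³`. -/
def coordIncl (p : ℍ[ℝ] × QSphere × QSphere) : ℍ[ℝ] × ℍ[ℝ] × ℍ[ℝ] := (p.1, p.2.1, p.2.2)

theorem coordEntries_mem (p : ℍ[ℝ] × QSphere × QSphere) :
    (Matrix.of (coordEntries (coordIncl p))) ∈ Sp11 := by
  obtain ⟨v, s, t⟩ := p
  have hv : ((diagNorm v ^ 2 : ℝ) : ℍ[ℝ]) = 1 + star v * v := by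
    rw [diagNorm_sq, star_mul_self_eq_coe_norm_sq]; simp
  have hv' : ((diagNorm v ^ 2 : ℝ) : ℍ[ℝ]) = 1 + v * star v := by
    rw [diagNorm_sq, mul_star_self_eq_coe_norm_sq]; simp
  have hdiag : ∀ x : QSphere, diagNorm v • diagNorm v • (star (x : ℍ[ℝ]) * x) =
      ((diagNorm v ^ 2 : ℝ) : ℍ[ℝ]) := by
    intro x
    rw [QSphere.star_mul, smul_smul, ← pow_two, ← Quaternion.coe_mul_eq_smul, mul_one]
  have e00 : diagNorm v • diagNorm v • (star (s : ℍ[ℝ]) * s) + -(star (s : ℍ[ℝ]) * star v * (v * s))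
      = 1 := by
    have : star (s : ℍ[ℝ]) * star v * (v * s) = star (s : ℍ[ℝ]) * (1 + star v * v) * s - 1 := by
      rw [mul_add, add_mul, mul_one, QSphere.star_mul]
      noncomm_ring
    rw [hdiag, this, ← hv, ← Quaternion.coe_commutes, mul_assoc, QSphere.star_mul]
    noncomm_ring
  have e11 : star (t : ℍ[ℝ]) * v * (star v * t) + -(diagNorm v • diagNorm v • (star (t : ℍ[ℝ]) * t))
      = -1 := by
    have : star (t : ℍ[ℝ]) * v * (star v * t) = star (t : ℍ[ℝ]) * (1 + v * star v) * t - 1 := by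
      rw [mul_add, add_mul, mul_one, QSphere.star_mul]
      noncomm_ring
    rw [hdiag, this, ← hv', ← Quaternion.coe_commutes, mul_assoc, QSphere.star_mul]
    noncomm_ring
  rw [mem_Sp11]
  ext i j : 1
  fin_cases i <;> fin_cases j
  · simpa [I11, Matrix.mul_apply, Fin.sum_univ_two, Matrix.conjTranspose_apply, coordEntries,
      coordIncl] using e00
  · simp [I11, Matrix.mul_apply, Fin.sum_univ_two, Matrix.conjTranspose_apply, coordEntries,
      coordIncl, mul_assoc]
  · simp [I11, Matrix.mul_apply, Fin.sum_univ_two, Matrix.conjTranspose_apply, coordEntries,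
      coordIncl, mul_assoc]
  · simpa [I11, Matrix.mul_apply, Fin.sum_univ_two, Matrix.conjTranspose_apply, coordEntries,
      coordIncl] using e11

theorem entryCoords_coordEntries (p : ℍ[ℝ] × QSphere × QSphere) :
    entryCoords (coordEntries (coordIncl p)) = coordIncl p := by
  obtain ⟨v, s, t⟩ := p
  -- The lower left entry `vs` has the norm of `v`, so the scale `diagNorm v` can be read off from
  -- that entry alone.
  have hn : diagNorm (v * s) = diagNorm v := by
    rw [diagNorm, norm_mul, QSphere.norm_eq, mul_one, diagNorm]
  have h0 := (diagNorm_pos v).ne'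
  simp [entryCoords, coordEntries, coordIncl, hn, mul_assoc, QSphere.mul_star, smul_smul, h0]

theorem Sp11.norm_diag (A : Sp11) :
    ‖A.1 0 0‖ = diagNorm (A.1 1 0) ∧ ‖A.1 1 1‖ = diagNorm (A.1 1 0) := by
  have h1 := norm_sq_eq_of_star_mul (Sp11.star_mul_rel A).1
  have h2 := norm_sq_eq_of_mul_star (Sp11.mul_star_rel A).2.2
  constructor
  · rw [diagNorm, ← h1, Real.sqrt_sq (norm_nonneg _)]
  · rw [diagNorm, ← h2, Real.sqrt_sq (norm_nonneg _)]

theorem norm_inv_diagNorm_smul {x v : ℍ[ℝ]} (h : ‖x‖ = diagNorm v) :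
    (diagNorm v)⁻¹ • x ∈ QSphere := by
  rw [mem_sphere_zero_iff_norm, norm_smul, norm_inv, Real.norm_eq_abs,
    abs_of_pos (diagNorm_pos v), h, inv_mul_cancel₀ (diagNorm_pos v).ne']

theorem coordEntries_entryCoords (A : Sp11) : coordEntries (entryCoords (Sp11.incl A)) =
    Sp11.incl A := by
  obtain ⟨n1, n2⟩ := Sp11.norm_diag A
  have r := (Sp11.star_mul_rel A).2.1
  have h0 := (diagNorm_pos (A.1 1 0)).ne'
  have hcoe : ∀ x : ℍ[ℝ], ((diagNorm (A.1 1 0) ^ 2 : ℝ) : ℍ[ℝ]) * x =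
    (diagNorm (A.1 1 0) * diagNorm (A.1 1 0)) • x := fun x => by
      rw [Quaternion.coe_mul_eq_smul, pow_two]
  have hn : diagNorm ((diagNorm (A.1 1 0))⁻¹ • (A.1 1 0 * star (A.1 0 0))) =
      diagNorm (A.1 1 0) := by
    rw [diagNorm, norm_smul, norm_mul, norm_star, n1, norm_inv, Real.norm_eq_abs,
      abs_of_pos (diagNorm_pos _), diagNorm]
    rw [← diagNorm]
    congr 3
    field_simp
  have hbaa : A.1 1 0 * star (A.1 0 0) * A.1 0 0 =
      (diagNorm (A.1 1 0) * diagNorm (A.1 1 0)) • A.1 1 0 := by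
    rw [mul_assoc, star_mul_self_eq_coe_norm_sq, n1, ← Quaternion.coe_commutes, hcoe]
  -- The upper right entry is determined by the others: column orthogonality gives `b̄ d = ā c`,
  -- whence `a b̄ d = |a|² c`.
  have habd : A.1 0 0 * star (A.1 1 0) * A.1 1 1 =
      (diagNorm (A.1 1 0) * diagNorm (A.1 1 0)) • A.1 0 1 := by
    rw [mul_assoc, ← r, ← mul_assoc, mul_star_self_eq_coe_norm_sq, n1, hcoe]
  funext i j
  fin_cases i <;> fin_cases j
  · simp [coordEntries, entryCoords, Sp11.incl, hn, smul_smul, h0]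
  · simp [coordEntries, entryCoords, Sp11.incl, smul_smul, habd]
    rw [inv_mul_cancel_left₀ h0, inv_mul_cancel₀ h0, one_smul]
  · simp [coordEntries, entryCoords, Sp11.incl, smul_smul, hbaa]
    rw [inv_mul_cancel_left₀ h0, inv_mul_cancel₀ h0, one_smul]
  · simp [coordEntries, entryCoords, Sp11.incl, hn, smul_smul, h0]

theorem Sp11.incl_injective : Function.Injective Sp11.incl := fun _ _ h =>
  Subtype.ext (Matrix.ext fun i j => congrFun (congrFun h i) j)

theorem coordIncl_injective : Function.Injective coordIncl := by
  rintro ⟨v, s, t⟩ ⟨v', s', t'⟩ h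
  simpa [coordIncl, Subtype.ext_iff] using h

/-- The bijection of `Sp(1,1)` with `ℍ × S³ × S³`. -/
noncomputable def Sp11.coords : Sp11 ≃ ℍ[ℝ] × QSphere × QSphere where
  toFun A := ((entryCoords (Sp11.incl A)).1,
    ⟨(entryCoords (Sp11.incl A)).2.1, norm_inv_diagNorm_smul (Sp11.norm_diag A).1⟩,
    ⟨(entryCoords (Sp11.incl A)).2.2, norm_inv_diagNorm_smul (Sp11.norm_diag A).2⟩)
  invFun p := ⟨Matrix.of (coordEntries (coordIncl p)), coordEntries_mem p⟩
  left_inv A := Sp11.incl_injective (coordEntries_entryCoords A)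
  right_inv p := coordIncl_injective (entryCoords_coordEntries p)

theorem Sp11.incl_eq : Sp11.incl = coordEntries ∘ coordIncl ∘ Sp11.coords :=
  funext fun A => (coordEntries_entryCoords A).symm

end Coordinates

/-! ### The manifolds `Sp(1,1)` and `Sp(1,1) / Sp(1)I₂` -/

section SmoothStructures

/-- The model of `ℍ × S³`. -/
noncomputable abbrev quotientModel := 𝓘(ℝ, ℍ[ℝ]).prod (𝓡 3)

/-- The model of `ℍ × S³ × S³`. -/
noncomputable abbrev groupModel := 𝓘(ℝ, ℍ[ℝ]).prod ((𝓡 3).prod (𝓡 3))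

theorem contMDiff_coe_QSphere : ContMDiff (𝓡 3) 𝓘(ℝ, ℍ[ℝ]) ∞ ((↑) : QSphere → ℍ[ℝ]) :=
  contMDiff_coe_sphere

theorem contMDiff_coordIncl :
    ContMDiff groupModel 𝓘(ℝ, ℍ[ℝ] × ℍ[ℝ] × ℍ[ℝ]) ∞ coordIncl :=
  contMDiff_fst.prodMk_space
    ((contMDiff_coe_QSphere.comp (contMDiff_fst.comp contMDiff_snd)).prodMk_space
      (contMDiff_coe_QSphere.comp (contMDiff_snd.comp contMDiff_snd)))

theorem isEmbedding_coordIncl : IsEmbedding coordIncl :=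
  IsEmbedding.id.prodMap (IsEmbedding.subtypeVal.prodMap IsEmbedding.subtypeVal)

theorem mfderiv_coordIncl_injective (p : ℍ[ℝ] × QSphere × QSphere) :
    Function.Injective (mfderiv groupModel 𝓘(ℝ, ℍ[ℝ] × ℍ[ℝ] × ℍ[ℝ]) coordIncl p) := by
  let D (s : QSphere) : EuclideanSpace ℝ (Fin 3) →L[ℝ] ℍ[ℝ] :=
    mfderiv (𝓡 3) 𝓘(ℝ, ℍ[ℝ]) ((↑) : QSphere → ℍ[ℝ]) s
  have hD : ∀ s, HasMFDerivAt (𝓡 3) 𝓘(ℝ, ℍ[ℝ]) ((↑) : QSphere → ℍ[ℝ]) s (D s) := fun s =>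
    (contMDiff_coe_QSphere.mdifferentiable (by simp) s).hasMFDerivAt
  have hDinj : ∀ s, Function.Injective (D s) := by
    intro s
    have h := injective_mvfderiv_subtypeVal_sphere (E := ℍ[ℝ]) (n := 3) s
    exact h
  have h1 : HasMFDerivAt groupModel 𝓘(ℝ, ℍ[ℝ]) Prod.fst p
      (ContinuousLinearMap.fst ℝ ℍ[ℝ] (EuclideanSpace ℝ (Fin 3) × EuclideanSpace ℝ (Fin 3))) :=
    hasMFDerivAt_fst p
  have h2 : HasMFDerivAt groupModel 𝓘(ℝ, ℍ[ℝ])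
      (fun p : ℍ[ℝ] × QSphere × QSphere => (p.2.1 : ℍ[ℝ])) p
      ((D p.2.1).comp ((ContinuousLinearMap.fst ℝ _ _).comp (ContinuousLinearMap.snd ℝ _ _))) :=
    HasMFDerivAt.comp p (hD _) (HasMFDerivAt.comp p (hasMFDerivAt_fst _) (hasMFDerivAt_snd _))
  have h3 : HasMFDerivAt groupModel 𝓘(ℝ, ℍ[ℝ])
      (fun p : ℍ[ℝ] × QSphere × QSphere => (p.2.2 : ℍ[ℝ])) p
      ((D p.2.2).comp ((ContinuousLinearMap.snd ℝ _ _).comp (ContinuousLinearMap.snd ℝ _ _))) :=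
    HasMFDerivAt.comp p (hD _) (HasMFDerivAt.comp p (hasMFDerivAt_snd _) (hasMFDerivAt_snd _))
  let L : ℍ[ℝ] × EuclideanSpace ℝ (Fin 3) × EuclideanSpace ℝ (Fin 3) →L[ℝ]
      ℍ[ℝ] × ℍ[ℝ] × ℍ[ℝ] := (ContinuousLinearMap.fst ℝ _ _).prod
    (((D p.2.1).comp ((ContinuousLinearMap.fst ℝ _ _).comp (ContinuousLinearMap.snd ℝ _ _))).prod
      ((D p.2.2).comp ((ContinuousLinearMap.snd ℝ _ _).comp (ContinuousLinearMap.snd ℝ _ _))))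
  have h : HasMFDerivAt groupModel 𝓘(ℝ, ℍ[ℝ] × ℍ[ℝ] × ℍ[ℝ]) coordIncl p L :=
    ⟨contMDiff_coordIncl.continuous.continuousAt,
      h1.2.prodMk (h2.2.prodMk h3.2)⟩
  have hL : Function.Injective L := by
    rintro ⟨x, y, z⟩ ⟨x', y', z'⟩ e
    have e1 : x = x' := congrArg Prod.fst e
    have e2 : D p.2.1 y = D p.2.1 y' := congrArg (fun w => w.2.1) e
    have e3 : D p.2.2 z = D p.2.2 z' := congrArg (fun w => w.2.2) e
    rw [e1, hDinj _ e2, hDinj _ e3]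
  rw [h.mfderiv]
  exact hL

theorem contMDiff_coordEntries_coordIncl :
    ContMDiff groupModel 𝓘(ℝ, Fin 2 → Fin 2 → ℍ[ℝ]) ∞ (coordEntries ∘ coordIncl) :=
  contDiff_coordEntries.contMDiff.comp contMDiff_coordIncl

/-- The differential of the inner map of a composition is injective if that of the composition
is. -/
theorem mfderiv_injective_of_comp {E₁ E₂ E₃ H₁ H₂ H₃ M₁ M₂ M₃ : Type*}
    [NormedAddCommGroup E₁] [NormedSpace ℝ E₁] [NormedAddCommGroup E₂] [NormedSpace ℝ E₂]
    [NormedAddCommGroup E₃] [NormedSpace ℝ E₃] [TopologicalSpace H₁] [TopologicalSpace H₂]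
    [TopologicalSpace H₃] [TopologicalSpace M₁] [TopologicalSpace M₂] [TopologicalSpace M₃]
    [ChartedSpace H₁ M₁] [ChartedSpace H₂ M₂] [ChartedSpace H₃ M₃]
    {I₁ : ModelWithCorners ℝ E₁ H₁} {I₂ : ModelWithCorners ℝ E₂ H₂}
    {I₃ : ModelWithCorners ℝ E₃ H₃} {f : M₁ → M₂} {g : M₂ → M₃} {x : M₁}
    (hg : MDifferentiableAt I₂ I₃ g (f x)) (hf : MDifferentiableAt I₁ I₂ f x)
    (h : Function.Injective (mfderiv I₁ I₃ (g ∘ f) x)) :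
    Function.Injective (mfderiv I₁ I₂ f x) := by
  rw [mfderiv_comp x hg hf] at h
  exact Function.Injective.of_comp h

/-- The differential of a composition of maps with injective differentials is injective. -/
theorem mfderiv_comp_injective {E₁ E₂ E₃ H₁ H₂ H₃ M₁ M₂ M₃ : Type*}
    [NormedAddCommGroup E₁] [NormedSpace ℝ E₁] [NormedAddCommGroup E₂] [NormedSpace ℝ E₂]
    [NormedAddCommGroup E₃] [NormedSpace ℝ E₃] [TopologicalSpace H₁] [TopologicalSpace H₂]
    [TopologicalSpace H₃] [TopologicalSpace M₁] [TopologicalSpace M₂] [TopologicalSpace M₃]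
    [ChartedSpace H₁ M₁] [ChartedSpace H₂ M₂] [ChartedSpace H₃ M₃]
    {I₁ : ModelWithCorners ℝ E₁ H₁} {I₂ : ModelWithCorners ℝ E₂ H₂}
    {I₃ : ModelWithCorners ℝ E₃ H₃} {f : M₁ → M₂} {g : M₂ → M₃} {x : M₁}
    (hg : MDifferentiableAt I₂ I₃ g (f x)) (hf : MDifferentiableAt I₁ I₂ f x)
    (hg' : Function.Injective (mfderiv I₂ I₃ g (f x)))
    (hf' : Function.Injective (mfderiv I₁ I₂ f x)) :
    Function.Injective (mfderiv I₁ I₃ (g ∘ f) x) := by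
  rw [mfderiv_comp x hg hf]
  exact hg'.comp hf'

/-- The structure of a manifold on `Sp(1,1)`. -/
noncomputable def Sp11.smoothStructure : SmoothStructure Sp11 :=
  SmoothStructure.ofEquiv groupModel Sp11.coords

/-- Composing the inclusion with the globally smooth `entryCoords` gives the standard embedding of
`ℍ × S³ × S³` in `ℍ³`, read in coordinates. Being a topological embedding and an immersion descends
from this composite to its inner factor. -/
theorem Sp11.isSubmanifoldStructure : IsSubmanifoldStructure Sp11.smoothStructure := by
  let S := Sp11.smoothStructure
  let _ := S.top
  let _ := S.chartedSpace
  have hφ : ContMDiff 𝓘(ℝ, S.Model) groupModel ∞ Sp11.coords :=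
    SmoothStructure.contMDiff_ofEquiv _ _
  have hφ' : ContMDiff groupModel 𝓘(ℝ, S.Model) ∞ Sp11.coords.symm :=
    SmoothStructure.contMDiff_ofEquiv_symm _ _
  have hφe : IsEmbedding Sp11.coords := (Homeomorph.mk Sp11.coords hφ.continuous
    hφ'.continuous).isEmbedding
  have hincl : ContMDiff 𝓘(ℝ, S.Model) 𝓘(ℝ, Fin 2 → Fin 2 → ℍ[ℝ]) ∞ Sp11.incl := by
    rw [Sp11.incl_eq]
    exact contMDiff_coordEntries_coordIncl.comp hφ
  have hcomp : entryCoords ∘ Sp11.incl = coordIncl ∘ Sp11.coords := rfl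
  refine ⟨?_, hincl, fun A => ?_⟩
  · refine IsEmbedding.of_comp hincl.continuous contDiff_entryCoords.continuous ?_
    rw [hcomp]
    exact isEmbedding_coordIncl.comp hφe
  · refine mfderiv_injective_of_comp (I₃ := 𝓘(ℝ, ℍ[ℝ] × ℍ[ℝ] × ℍ[ℝ])) (g := entryCoords)
      (contDiff_entryCoords.contMDiff.mdifferentiable (by simp) _)
      (hincl.mdifferentiable (by simp) _) ?_
    rw [hcomp]
    refine mfderiv_comp_injective (contMDiff_coordIncl.mdifferentiable (by simp) _)
      (hφ.mdifferentiable (by simp) _) (mfderiv_coordIncl_injective _) ?_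
    refine mfderiv_injective_of_comp (g := Sp11.coords.symm) (I₃ := 𝓘(ℝ, S.Model))
      (hφ'.mdifferentiable (by simp) _) (hφ.mdifferentiable (by simp) _) ?_
    rw [Equiv.symm_comp_self, mfderiv_id]
    exact Function.injective_id

/-- The projection `(v, s, t) ↦ (v, t s⁻¹)`. -/
noncomputable def coordProj (p : ℍ[ℝ] × QSphere × QSphere) : ℍ[ℝ] × QSphere :=
  (p.1, p.2.2 * p.2.1⁻¹)

theorem contMDiff_QSphere_mul_inv : ContMDiff ((𝓡 3).prod (𝓡 3)) (𝓡 3) ∞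
    (fun p : QSphere × QSphere => p.1 * p.2⁻¹) := by
  have h1 : ContMDiff ((𝓡 3).prod (𝓡 3)) 𝓘(ℝ, ℍ[ℝ]) ∞
      (fun p : QSphere × QSphere => (p.1 : ℍ[ℝ])) := contMDiff_coe_QSphere.comp contMDiff_fst
  have h2 : ContMDiff ((𝓡 3).prod (𝓡 3)) 𝓘(ℝ, ℍ[ℝ]) ∞
      (fun p : QSphere × QSphere => star (p.2 : ℍ[ℝ])) :=
    contDiff_quaternion_star.contMDiff.comp (contMDiff_coe_QSphere.comp contMDiff_snd)
  have h3 : ContMDiff ((𝓡 3).prod (𝓡 3)) 𝓘(ℝ, ℍ[ℝ]) ∞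
      (fun p : QSphere × QSphere => (p.1 : ℍ[ℝ]) * star (p.2 : ℍ[ℝ])) :=
    (contDiff_mul (𝕜 := ℝ) (𝔸 := ℍ[ℝ])).contMDiff.comp (h1.prodMk_space h2)
  have h4 : ∀ p : QSphere × QSphere, (p.1 : ℍ[ℝ]) * star (p.2 : ℍ[ℝ]) ∈ QSphere := by
    intro p
    rw [← QSphere.coe_inv]
    exact (p.1 * p.2⁻¹).2
  have h5 : (fun p : QSphere × QSphere => p.1 * p.2⁻¹) = Set.codRestrict _ _ h4 := by
    funext p
    refine Subtype.ext ?_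
    rw [Set.val_codRestrict_apply, ← QSphere.coe_inv]
    rfl
  rw [h5]
  exact h3.codRestrict_sphere h4

theorem contMDiff_coordProj : ContMDiff groupModel quotientModel ∞ coordProj :=
  contMDiff_fst.prodMk (contMDiff_QSphere_mul_inv.comp
    ((contMDiff_snd.comp contMDiff_snd).prodMk (contMDiff_fst.comp contMDiff_snd)))

/-- The section `(v, r) ↦ (v, s, r s)` of `coordProj`. -/
noncomputable def coordSection (s : QSphere) (p : ℍ[ℝ] × QSphere) : ℍ[ℝ] × QSphere × QSphere :=
  (p.1, s, p.2 * s)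

theorem contMDiff_coordSection (s : QSphere) :
    ContMDiff quotientModel groupModel ∞ (coordSection s) := by
  have h : ContMDiff quotientModel (𝓡 3) ∞ (fun p : ℍ[ℝ] × QSphere => p.2 * s) := by
    have h1 := contMDiff_QSphere_mul_inv.comp (contMDiff_snd.prodMk
      (contMDiff_const (c := s⁻¹) (I := quotientModel) (M := ℍ[ℝ] × QSphere)))
    refine h1.congr fun p => ?_
    simp
  exact contMDiff_fst.prodMk (contMDiff_const.prodMk h)

theorem coordProj_coordSection (s : QSphere) (p : ℍ[ℝ] × QSphere) :
    coordProj (coordSection s p) = p := by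
  simp [coordProj, coordSection]

theorem coordSection_coordProj (p : ℍ[ℝ] × QSphere × QSphere) :
    coordSection p.2.1 (coordProj p) = p := by
  simp [coordProj, coordSection]

/-- Right multiplication by `u` fixes `v` and replaces `(s, t)` by `(su, tu)`, so `(v, ts⁻¹)` is a
complete invariant of the left coset. -/
theorem inv_mul_mem_Sp1I2_iff {A B : Sp11} :
    A⁻¹ * B ∈ Sp1I2 ↔ coordProj (Sp11.coords A) = coordProj (Sp11.coords B) := by
  have key : ∀ (p : ℍ[ℝ] × QSphere × QSphere) (u : QSphere),
      coordEntries (coordIncl (p.1, p.2.1 * u, p.2.2 * u)) =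
        fun i j => coordEntries (coordIncl p) i j * u := by
    intro p u
    funext i j
    fin_cases i <;> fin_cases j <;> simp [coordEntries, coordIncl, mul_assoc]
  have h1 : ∀ u : QSphere, (A⁻¹ * B).1 = Matrix.diagonal (fun _ => (u : ℍ[ℝ])) ↔
      Sp11.coords B = ((Sp11.coords A).1, (Sp11.coords A).2.1 * u, (Sp11.coords A).2.2 * u) := by
    intro u
    have e1 : A.1 * (A⁻¹ * B).1 = B.1 := by
      rw [← Submonoid.coe_mul, mul_inv_cancel_left]
    have e2 : (A⁻¹).1 * A.1 = 1 := congrArg Subtype.val (inv_mul_cancel A)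
    have e3 : (A⁻¹ * B).1 = Matrix.diagonal (fun _ => (u : ℍ[ℝ])) ↔
        Sp11.incl B = fun i j => Sp11.incl A i j * u := by
      constructor
      · intro h
        funext i j
        change B.1 i j = A.1 i j * u
        rw [← e1, h, Matrix.mul_diagonal]
      · intro h
        have : B.1 = A.1 * Matrix.diagonal (fun _ => (u : ℍ[ℝ])) := by
          ext i j : 1
          rw [Matrix.mul_diagonal]
          exact congrFun (congrFun h i) j
        rw [Submonoid.coe_mul, this, ← mul_assoc, e2, one_mul]
    have e4 : (fun i j => Sp11.incl A i j * (u : ℍ[ℝ])) = Sp11.incl (Sp11.coords.symm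
        ((Sp11.coords A).1, (Sp11.coords A).2.1 * u, (Sp11.coords A).2.2 * u)) := by
      rw [Sp11.incl_eq]
      simp only [Function.comp, Equiv.apply_symm_apply]
      rw [key]
    rw [e3, e4, Sp11.incl_injective.eq_iff, Equiv.eq_symm_apply]
  constructor
  · rintro ⟨u, hu, h⟩
    rw [(h1 ⟨u, mem_sphere_zero_iff_norm.2 hu⟩).1 h]
    simp [coordProj]
  · intro h
    obtain ⟨a1, a2⟩ := Prod.ext_iff.1 h
    change (Sp11.coords A).1 = (Sp11.coords B).1 at a1
    change (Sp11.coords A).2.2 * (Sp11.coords A).2.1⁻¹ =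
      (Sp11.coords B).2.2 * (Sp11.coords B).2.1⁻¹ at a2
    let u : QSphere := (Sp11.coords A).2.1⁻¹ * (Sp11.coords B).2.1
    refine ⟨u, QSphere.norm_eq u, (h1 u).2 ?_⟩
    rw [a1]
    refine Prod.ext rfl (Prod.ext ?_ ?_)
    · simp [u]
    · simp only [u]
      rw [← mul_assoc, a2, inv_mul_cancel_right]

/-- The bijection of `Sp(1,1) / Sp(1) I₂` with `ℍ × S³`. -/
noncomputable def quotientCoords : Sp11 ⧸ Sp1I2 ≃ ℍ[ℝ] × QSphere :=
  Equiv.ofBijective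
    (Quotient.lift (fun A : Sp11 => coordProj (Sp11.coords A)) fun _ _ h =>
      inv_mul_mem_Sp1I2_iff.1 (QuotientGroup.leftRel_apply.1 h))
    ⟨by
      intro x y h
      induction x using QuotientGroup.induction_on with | H A => ?_
      induction y using QuotientGroup.induction_on with | H B => ?_
      exact QuotientGroup.eq.2 (inv_mul_mem_Sp1I2_iff.2 h), fun p =>
        ⟨(Sp11.coords.symm (coordSection 1 p) : Sp11), by
          change coordProj (Sp11.coords (Sp11.coords.symm _)) = p
          rw [Equiv.apply_symm_apply, coordProj_coordSection]⟩⟩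

theorem quotientCoords_mk (A : Sp11) :
    quotientCoords (A : Sp11 ⧸ Sp1I2) = coordProj (Sp11.coords A) := rfl

/-- The structure of a manifold on `Sp(1,1) / Sp(1) I₂`. -/
noncomputable def quotientSmoothStructure : SmoothStructure (Sp11 ⧸ Sp1I2) :=
  SmoothStructure.ofEquiv quotientModel quotientCoords

theorem dim_quotientSmoothStructure : quotientSmoothStructure.dim = 7 := by
  rw [quotientSmoothStructure, SmoothStructure.dim_ofEquiv, Module.finrank_prod,
    Quaternion.finrank_eq_four, finrank_euclideanSpace_fin]

/-- A smooth map with smooth sections through every point is a submersion. -/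
theorem SmoothStructure.isSurjectiveSubmersion_of_section {X Y : Type*} {S : SmoothStructure X}
    {T : SmoothStructure Y} {p : X → Y} (hs : Function.Surjective p) (hp : S.SmoothMap T p)
    (h : ∀ x, ∃ σ : Y → X, T.SmoothMap S σ ∧ p ∘ σ = id ∧ σ (p x) = x) :
    S.IsSurjectiveSubmersion T p := by
  let _ := S.top
  let _ := S.chartedSpace
  let _ := T.top
  let _ := T.chartedSpace
  refine ⟨hs, hp, fun x => ?_⟩
  obtain ⟨σ, hσ, hid, hx⟩ := h x
  have hσ : ContMDiff 𝓘(ℝ, T.Model) 𝓘(ℝ, S.Model) ∞ σ := hσ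
  have hp : ContMDiff 𝓘(ℝ, S.Model) 𝓘(ℝ, T.Model) ∞ p := hp
  have h1 := mfderiv_comp (p x) (hp.mdifferentiable (by simp) (σ (p x)))
    (hσ.mdifferentiable (by simp) (p x))
  rw [hid, mfderiv_id, hx] at h1
  intro v
  exact ⟨_, (DFunLike.congr_fun h1 v).symm⟩

/-- In coordinates, freezing `s` at its value for `A` gives a global smooth section through `A`,
which forces the differential there to be surjective. -/
theorem isQuotientStructure_quotientSmoothStructure :
    IsQuotientStructure Sp11.smoothStructure quotientSmoothStructure := by
  let S := Sp11.smoothStructure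
  let _ := S.top
  let _ := S.chartedSpace
  let T := quotientSmoothStructure
  let _ := T.top
  let _ := T.chartedSpace
  have hφ : ContMDiff 𝓘(ℝ, S.Model) groupModel ∞ Sp11.coords :=
    SmoothStructure.contMDiff_ofEquiv _ _
  have hφ' : ContMDiff groupModel 𝓘(ℝ, S.Model) ∞ Sp11.coords.symm :=
    SmoothStructure.contMDiff_ofEquiv_symm _ _
  have hk : ContMDiff 𝓘(ℝ, T.Model) quotientModel ∞ quotientCoords :=
    SmoothStructure.contMDiff_ofEquiv _ _
  have hk' : ContMDiff quotientModel 𝓘(ℝ, T.Model) ∞ quotientCoords.symm :=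
    SmoothStructure.contMDiff_ofEquiv_symm _ _
  have hmk : (fun A : Sp11 => (A : Sp11 ⧸ Sp1I2)) =
      quotientCoords.symm ∘ coordProj ∘ Sp11.coords := by
    funext A
    exact (quotientCoords.symm_apply_apply _).symm
  refine SmoothStructure.isSurjectiveSubmersion_of_section Quotient.mk_surjective ?_ fun A => ?_
  · rw [hmk]
    exact hk'.comp (contMDiff_coordProj.comp hφ)
  · refine ⟨Sp11.coords.symm ∘ coordSection (Sp11.coords A).2.1 ∘ quotientCoords,
      hφ'.comp ((contMDiff_coordSection _).comp hk), ?_, ?_⟩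
    · rw [hmk]
      funext x
      simp [coordProj_coordSection]
    · simp only [Function.comp, quotientCoords_mk, coordSection_coordProj,
        Equiv.symm_apply_apply]

end SmoothStructures

/-! ### The map `ψ` and the main theorem -/

/-- The map `A Sp(1)I₂ ↦ 𝓕_{A⁻¹}`. -/
noncomputable def mobiusOfCoset : Sp11 ⧸ Sp1I2 → RegularMobiusMaps :=
  Quotient.lift (fun A : Sp11 => (⟨fun q => ⟨regularMobius A⁻¹ q,
      mem_ball_zero_iff.2 (norm_regularMobius_lt_one _ q)⟩, A⁻¹, fun _ => rfl⟩ :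
        RegularMobiusMaps)) fun A B h => by
    -- The fibre criterion concerns right cosets; applied to `B⁻¹` and `A⁻¹` it becomes the left
    -- coset relation between `A` and `B`.
    have h : A⁻¹ * B⁻¹⁻¹ ∈ Sp1I2 := by rw [inv_inv]; exact QuotientGroup.leftRel_apply.1 h
    have := regularMobius_eq_iff.2 h
    refine Subtype.ext (funext fun q => Subtype.ext ?_)
    exact (congrFun this q).symm

theorem coe_mobiusOfCoset_mk (A : Sp11) (q : QBall) :
    ((mobiusOfCoset (A : Sp11 ⧸ Sp1I2) : QBall → QBall) q : ℍ[ℝ]) = regularMobius A⁻¹ q := rfl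

theorem bijective_mobiusOfCoset : Function.Bijective mobiusOfCoset := by
  constructor
  · intro x y h
    induction x using QuotientGroup.induction_on with | H A => ?_
    induction y using QuotientGroup.induction_on with | H B => ?_
    have h1 : regularMobius B⁻¹ = regularMobius A⁻¹ := by
      funext q
      rw [← coe_mobiusOfCoset_mk, ← coe_mobiusOfCoset_mk, h]
    refine QuotientGroup.eq.2 ?_
    simpa using regularMobius_eq_iff.1 h1
  · rintro ⟨F, A, hA⟩
    refine ⟨(A⁻¹ : Sp11), Subtype.ext (funext fun q => Subtype.ext ?_)⟩
    rw [coe_mobiusOfCoset_mk, inv_inv, hA]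

theorem mainTheorem2 :
    ∃ ψ : Sp11 ⧸ Sp1I2 → RegularMobiusMaps,
      -- the map `A Sp(1)I₂ ↦ 𝓕_{A⁻¹}` is well defined and bijective
      (∀ (A : Sp11) (q : QBall),
        ((ψ (A : Sp11 ⧸ Sp1I2) : QBall → QBall) q : ℍ[ℝ]) = regularMobius A⁻¹ q) ∧
      Function.Bijective ψ ∧
      -- the manifold structures of `Sp(1,1)` and of the quotient exist and are unique
      (∃! G : SmoothStructure Sp11, IsSubmanifoldStructure G) ∧
      ∀ G : SmoothStructure Sp11, IsSubmanifoldStructure G →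
        (∃! Q : SmoothStructure (Sp11 ⧸ Sp1I2), IsQuotientStructure G Q) ∧
        ∀ Q : SmoothStructure (Sp11 ⧸ Sp1I2), IsQuotientStructure G Q →
          -- there is a unique manifold structure making `ψ` a diffeomorphism; its dimension is 7
          (∃! S : SmoothStructure RegularMobiusMaps, Q.IsDiffeomorphism S ψ) ∧
          ∀ S : SmoothStructure RegularMobiusMaps, Q.IsDiffeomorphism S ψ → S.dim = 7 := by
  refine ⟨mobiusOfCoset, coe_mobiusOfCoset_mk, bijective_mobiusOfCoset,
    ⟨_, Sp11.isSubmanifoldStructure, fun G hG => hG.unique Sp11.isSubmanifoldStructure⟩,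
    fun G hG => ?_⟩
  -- Uniqueness reduces an arbitrary admissible structure to the one built from coordinates, where
  -- the quotient and its dimension are explicit.
  obtain rfl : G = Sp11.smoothStructure :=
    SmoothStructure.IsEmbeddingInto.unique hG Sp11.isSubmanifoldStructure
  refine ⟨⟨_, isQuotientStructure_quotientSmoothStructure, fun Q hQ =>
    hQ.unique isQuotientStructure_quotientSmoothStructure⟩, fun Q hQ => ?_⟩
  obtain rfl : Q = quotientSmoothStructure :=
    SmoothStructure.IsSurjectiveSubmersion.unique hQ isQuotientStructure_quotientSmoothStructure
  let ψ : Sp11 ⧸ Sp1I2 ≃ RegularMobiusMaps := Equiv.ofBijective _ bijective_mobiusOfCoset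
  have : Nonempty RegularMobiusMaps := ⟨ψ ((1 : Sp11) : Sp11 ⧸ Sp1I2)⟩
  constructor
  · obtain ⟨S, hS⟩ := quotientSmoothStructure.exists_isDiffeomorphism ψ
    exact ⟨S, hS, fun S' hS' => SmoothStructure.IsDiffeomorphism.unique (f := ψ) hS' hS⟩
  · intro S hS
    have h := (SmoothStructure.isDiffeomorphism_iff (f := ψ)).1 hS
    rw [← dim_quotientSmoothStructure]
    exact (SmoothStructure.dim_eq_of_smoothMap ψ h.1 h.2).symm
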